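/- Let $K$ be a field, $Q$ a finite quiver and $\rho$ a set of quadratic relations, i.e. of $K$-linear combinations of paths of length $2$ in $Q$ (paths are composed from right to left). Put $A=KQ/\langle\rho\rangle$, with the length grading. Let $n\ge 2$ be an integer with $\operatorname{char}K\nmid n$, and let $\mathbb Z_n=\mathbb Z/n\mathbb Z$. Let $Q'$ be the quiver with vertices $(v,\bar r)$ and arrows $(a,\bar r):(i(a),\bar r)\to(t(a),\overline{r+1})$, where $v\in Q_0$, $a\in Q_1$ is an arrow from $i(a)$ to $t(a)$, and $\bar r\in\mathbb Z_n$. Let $$\rho'=\Big\{\sum_i k_i\,(a_{i2},\overline{r+1})(a_{i1},\overline{r})\ \Big|\ \sum_i k_i\,a_{i2}a_{i1}\in\rho,\ \bar r\in\mathbb Z_n\Big\},$$ and $A'=KQ'/\langle\rho'\rangle$, with the length grading. A graded $K$-algebra $B=\bigoplus_{i\ge0}B_i$ is a graded quiver algebra if $B_0\cong K^s$ as $K$-algebras for some $s\ge1$, every $B_i$ is finite-dimensional, and $B_i=B_1^i$ for $i\ge2$. A Yoneda algebra $E=\operatorname{Ext}^*_B(M,M)$ is generated in degrees $0$ and $1$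 if $E^i=(E^1)^i$ for $i\ge2$. (1) Call a finite-dimensional graded quiver algebra $B$ with Jacobson radical $J$ Koszul if $\operatorname{Ext}_B^*(B/J,B/J)$ is generated in degrees $0$ and $1$. If $A$ is finite-dimensional and Koszul, then $A'$ is a finite-dimensional Koszul algebra. (2) Call a graded quiver algebra $B$ of arbitrary dimension Koszul if $\operatorname{Ext}_B^*(B/B_+,B/B_+)$ is generated in degrees $0$ and $1$, where $B_+=\bigoplus_{i\ge1}B_i$. If $A$ is Koszul in this sense, then so is $A'$. -/

import Mathlib

open CategoryTheory

universe u v w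

/-! ### Path algebras -/

/-- The type of all paths of a quiver, with arbitrary source and target. -/
abbrev QuiverPath (V : Type u) [Quiver.{v} V] : Type (max u v) :=
  Σ a b : V, Quiver.Path a b

/-- The path algebra `K Q`: the `K`-vector space with basis all paths of the quiver (including the
trivial path at every vertex). -/
def PathAlgebra (K : Type w) [Field K] (V : Type u) [Quiver.{v} V] : Type (max u v w) :=
  QuiverPath V →₀ K

namespace PathAlgebra

noncomputable section

variable (K : Type w) [Field K] (V : Type u) [Quiver.{v} V]

instance : AddCommGroup (PathAlgebra K V) :=
  inferInstanceAs (AddCommGroup (QuiverPath V →₀ K))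

instance : Module K (PathAlgebra K V) :=
  inferInstanceAs (Module K (QuiverPath V →₀ K))

variable {V}

/-- A path, seen as a basis element of the path algebra. -/
def ofPath (p : QuiverPath V) : PathAlgebra K V :=
  Finsupp.single p (1 : K)

open Classical in
/-- The product of two paths. Paths are composed from right to left: `p * q` is the path
"first `q`, then `p`" when `q` ends where `p` starts, and `0` otherwise. -/
def mulPath (p q : QuiverPath V) : PathAlgebra K V :=
  if h : p.1 = q.2.1 then ofPath K ⟨q.1, p.2.1, q.2.2.comp (p.2.2.cast h rfl)⟩ else 0

variable {K} in
/-- The linear map on the path algebra with prescribed values on paths. -/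
def linearLift {M : Type*} [AddCommGroup M] [Module K M] (f : QuiverPath V → M) :
    PathAlgebra K V →ₗ[K] M :=
  (Finsupp.linearCombination K f : (QuiverPath V →₀ K) →ₗ[K] M)

variable {K} in
@[simp]
theorem linearLift_ofPath {M : Type*} [AddCommGroup M] [Module K M] (f : QuiverPath V → M)
    (p : QuiverPath V) : linearLift f (ofPath K p) = f p :=
  (Finsupp.linearCombination_single K (1 : K) p).trans (one_smul K (f p))

variable (V)

/-- The bilinear extension of `mulPath`. -/
def mulLin : PathAlgebra K V →ₗ[K] PathAlgebra K V →ₗ[K] PathAlgebra K V :=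
  linearLift fun p => linearLift (mulPath K p)

instance : Mul (PathAlgebra K V) := ⟨fun x y => mulLin K V x y⟩

instance [Fintype V] : One (PathAlgebra K V) :=
  ⟨∑ a : V, ofPath K ⟨a, a, Quiver.Path.nil⟩⟩

variable {K V}

theorem mul_def (x y : PathAlgebra K V) : x * y = mulLin K V x y := rfl

theorem one_def [Fintype V] :
    (1 : PathAlgebra K V) = ∑ a : V, ofPath K ⟨a, a, Quiver.Path.nil⟩ := rfl

theorem ofPath_mul_ofPath (p q : QuiverPath V) :
    ofPath K p * ofPath K q = mulPath K p q := by
  rw [mul_def, mulLin, linearLift_ofPath, linearLift_ofPath]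

theorem mulPath_of_eq {a b c : V} (q : Quiver.Path a b) (p : Quiver.Path b c) :
    mulPath K ⟨b, c, p⟩ ⟨a, b, q⟩ = ofPath K ⟨a, c, q.comp p⟩ := by
  simp [mulPath]

theorem mulPath_of_ne {p q : QuiverPath V} (h : p.1 ≠ q.2.1) : mulPath K p q = 0 := by
  simp [mulPath, h]

/-- Two linear maps on the path algebra that agree on paths are equal. -/
theorem lin_ext {M : Type*} [AddCommGroup M] [Module K M] {f g : PathAlgebra K V →ₗ[K] M}
    (h : ∀ p, f (ofPath K p) = g (ofPath K p)) : f = g :=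
  Finsupp.lhom_ext' fun p => LinearMap.ext_ring (h p)

theorem mulPath_assoc (p q r : QuiverPath V) :
    mulPath K p q * ofPath K r = ofPath K p * mulPath K q r := by
  obtain ⟨c, d, p⟩ := p
  obtain ⟨b, c', q⟩ := q
  obtain ⟨a, b', r⟩ := r
  by_cases h1 : c = c'
  · subst h1
    by_cases h2 : b = b'
    · subst h2
      rw [mulPath_of_eq, mulPath_of_eq, ofPath_mul_ofPath, ofPath_mul_ofPath, mulPath_of_eq,
        mulPath_of_eq, Quiver.Path.comp_assoc]
    · rw [mulPath_of_eq, ofPath_mul_ofPath, mulPath_of_ne (by exact h2),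
        mulPath_of_ne (by exact h2)]
      simp [mul_def]
  · rw [mulPath_of_ne (by exact h1)]
    by_cases h2 : b = b'
    · subst h2
      rw [mulPath_of_eq, ofPath_mul_ofPath, mulPath_of_ne (by exact h1)]
      simp [mul_def]
    · rw [mulPath_of_ne (by exact h2)]
      simp [mul_def]

instance : NonUnitalRing (PathAlgebra K V) where
  left_distrib x y z := by simp [mul_def]
  right_distrib x y z := by simp [mul_def]
  zero_mul x := by simp [mul_def]
  mul_zero x := by simp [mul_def]
  mul_assoc x y z := by
    have h1 (p q : QuiverPath V) : mulLin K V (mulPath K p q) =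
        mulLin K V (ofPath K p) ∘ₗ mulLin K V (ofPath K q) := by
      refine lin_ext fun r => ?_
      have := mulPath_assoc (K := K) p q r
      rwa [← ofPath_mul_ofPath q r] at this
    have h2 (p : QuiverPath V) : mulLin K V ∘ₗ mulLin K V (ofPath K p) =
        LinearMap.llcomp K _ _ _ (mulLin K V (ofPath K p)) ∘ₗ mulLin K V := by
      refine lin_ext fun q => ?_
      have := h1 p q
      rwa [← ofPath_mul_ofPath] at this
    have h3 : (mulLin K V).compr₂ (mulLin K V) =
        (LinearMap.llcomp K (PathAlgebra K V) (PathAlgebra K V) (PathAlgebra K V) ∘ₗ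
          mulLin K V).compl₂ (mulLin K V) :=
      lin_ext h2
    exact congrArg (fun f : PathAlgebra K V →ₗ[K] PathAlgebra K V →ₗ[K] PathAlgebra K V →ₗ[K]
      PathAlgebra K V => f x y z) h3

instance [Fintype V] : Ring (PathAlgebra K V) where
  __ := (inferInstance : NonUnitalRing (PathAlgebra K V))
  one_mul x := by
    classical
    have h : mulLin K V 1 = LinearMap.id := by
      refine lin_ext fun p => ?_
      obtain ⟨a, b, p⟩ := p
      rw [← mul_def, one_def, Finset.sum_mul, Finset.sum_eq_single b]
      · rw [ofPath_mul_ofPath, mulPath_of_eq]; rfl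
      · intro c _ hc
        rw [ofPath_mul_ofPath, mulPath_of_ne (by exact hc)]
      · simp
    exact congrArg (fun f => f x) h
  mul_one x := by
    classical
    have h : (mulLin K V).flip 1 = LinearMap.id := by
      refine lin_ext fun p => ?_
      obtain ⟨a, b, p⟩ := p
      rw [LinearMap.flip_apply, ← mul_def, one_def, Finset.mul_sum, Finset.sum_eq_single a]
      · rw [ofPath_mul_ofPath, mulPath_of_eq, Quiver.Path.nil_comp]; rfl
      · intro c _ hc
        rw [ofPath_mul_ofPath, mulPath_of_ne (by exact hc.symm)]
      · simp
    exact congrArg (fun f => f x) h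

instance [Fintype V] : Algebra K (PathAlgebra K V) :=
  Algebra.ofModule (fun c x y => by simp [mul_def]) (fun c x y => by simp [mul_def])

variable (K V)

/-- The span of the paths of length `i`. -/
def lengthPart (i : ℕ) : Submodule K (PathAlgebra K V) :=
  Submodule.span K {x | ∃ p : QuiverPath V, p.2.2.length = i ∧ x = ofPath K p}

variable {K V}

/-- The two-sided ideal `⟨ρ⟩` generated by a set of relations. -/
def relationIdeal [Fintype V] (ρ : Set (PathAlgebra K V)) : Ideal (PathAlgebra K V) :=
  (TwoSidedIdeal.span ρ).asIdeal

instance [Fintype V] (ρ : Set (PathAlgebra K V)) : (relationIdeal ρ).IsTwoSided :=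
  inferInstanceAs (TwoSidedIdeal.span ρ).asIdeal.IsTwoSided

end

end PathAlgebra

/-- The quiver algebra `K Q / ⟨ρ⟩`. -/
abbrev QuiverAlgebra {K : Type w} [Field K] {V : Type u} [Quiver.{v} V] [Fintype V]
    (ρ : Set (PathAlgebra K V)) : Type (max u v w) :=
  PathAlgebra K V ⧸ PathAlgebra.relationIdeal ρ

/-- The length grading of `K Q / ⟨ρ⟩`: degree `i` is the image of the span of the paths of
length `i`. -/
noncomputable def QuiverAlgebra.lengthGrading {K : Type w} [Field K] {V : Type u} [Quiver.{v} V] [Fintype V]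
    (ρ : Set (PathAlgebra K V)) (i : ℕ) : Submodule K (QuiverAlgebra ρ) :=
  (PathAlgebra.lengthPart K V i).map
    (Ideal.Quotient.mkₐ K (PathAlgebra.relationIdeal ρ)).toLinearMap

/-! ### Koszul algebras -/

/-- The part of `Ext^i(X, X)` generated by degrees `0` and `1` of the Yoneda algebra: it is
everything for `i = 0`, and the additive group generated by the Yoneda products of elements of
part `i` with elements of `Ext^1(X, X)` for `i + 1`. -/
noncomputable def extPow {R : Type u} [Ring R] (X : ModuleCat.{u} R) :
    (i : ℕ) → AddSubgroup (Abelian.Ext.{u} X X i)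
  | 0 => ⊤
  | i + 1 => AddSubgroup.closure
      {γ | ∃ α ∈ extPow X i, ∃ β : Abelian.Ext.{u} X X 1, γ = α.comp β rfl}

/-- The Yoneda algebra `Ext^*_R(M, M)` is generated in degrees `0` and `1`. -/
def ExtGeneratedInDegreeZeroOne (R : Type u) [Ring R] (M : Type u) [AddCommGroup M] [Module R M] :
    Prop :=
  ∀ i : ℕ, 2 ≤ i → extPow (ModuleCat.of R M) i = ⊤

/-- `R` is quasi-Koszul: `Ext^*_R(R/J, R/J)` is generated in degrees `0` and `1`, where `J` is the
Jacobson radical of `R`. -/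
def IsQuasiKoszul (R : Type u) [Ring R] : Prop :=
  ExtGeneratedInDegreeZeroOne R (R ⧸ Ring.jacobson R)

/-- `A` with the pieces `𝒜 i` is a graded quiver algebra: `A = ⨁ 𝒜 i` is a graded algebra with
`𝒜 0 ≅ K^r` as algebras for some `r ≥ 1`, all `𝒜 i` are finite-dimensional, and `A` is generated
in degrees `0` and `1`. -/
structure IsGradedQuiverAlgebra (K : Type w) [Field K] {A : Type u} [Ring A] [Algebra K A]
    (𝒜 : ℕ → Submodule K A) : Prop where
  gradedMonoid : SetLike.GradedMonoid 𝒜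
  isInternal : DirectSum.IsInternal 𝒜
  degree_zero : ∃ r : ℕ, 1 ≤ r ∧ ∃ S : Subalgebra K A, Subalgebra.toSubmodule S = 𝒜 0 ∧
    Nonempty (S ≃ₐ[K] (Fin r → K))
  finite : ∀ i, FiniteDimensional K (𝒜 i)
  generated : ∀ i, 2 ≤ i → 𝒜 i = 𝒜 1 ^ i

/-- A Koszul algebra as a quasi-Koszul graded quiver algebra (used for finite-dimensional
algebras). -/
def IsKoszul (K : Type w) [Field K] {A : Type u} [Ring A] [Algebra K A]
    (𝒜 : ℕ → Submodule K A) : Prop :=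
  IsGradedQuiverAlgebra K 𝒜 ∧ IsQuasiKoszul A

/-- The ideal `A₊ = ⨁_{i ≥ 1} 𝒜 i`. -/
def positiveIdeal {K : Type w} [Field K] {A : Type u} [Ring A] [Algebra K A]
    (𝒜 : ℕ → Submodule K A) : Ideal A :=
  Ideal.span {x | ∃ i, 1 ≤ i ∧ x ∈ 𝒜 i}

/-- A Koszul algebra in the sense used for graded quiver algebras of arbitrary dimension: the
Yoneda algebra of the module `A / A₊ ≅ 𝒜 0` is generated in degrees `0` and `1`. -/
def IsGradedKoszul (K : Type w) [Field K] {A : Type u} [Ring A] [Algebra K A]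
    (𝒜 : ℕ → Submodule K A) : Prop :=
  IsGradedQuiverAlgebra K 𝒜 ∧ ExtGeneratedInDegreeZeroOne A (A ⧸ positiveIdeal 𝒜)

/-! ### The cyclic covering quiver -/

/-- The vertices `(v, r)` of the `ℤ/n`-covering quiver. -/
structure CyclicCover (V : Type u) (n : ℕ) : Type u where
  base : V
  level : ZMod n

namespace CyclicCover

noncomputable section

variable {V : Type u} {n : ℕ}

instance [Fintype V] [NeZero n] : Fintype (CyclicCover V n) :=
  Fintype.ofEquiv (V × ZMod n)
    { toFun := fun x => ⟨x.1, x.2⟩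
      invFun := fun x => (x.base, x.level)
      left_inv := fun _ => rfl
      right_inv := fun _ => rfl }

/-- An arrow `(v, r) ⟶ (w, s)` is an arrow `a : v ⟶ w`, provided that `s = r + 1`; it is the arrow
`(a, r)`. -/
instance [Quiver.{v} V] : Quiver.{v} (CyclicCover V n) where
  Hom x y := {_a : x.base ⟶ y.base // y.level = x.level + 1}

variable [Quiver.{v} V]

/-- The arrow `(a, r) : (v, r) ⟶ (w, r + 1)`. -/
def liftArrow {v w : V} (a : v ⟶ w) (r : ZMod n) :
    (⟨v, r⟩ : CyclicCover V n) ⟶ ⟨w, r + 1⟩ :=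
  ⟨a, rfl⟩

/-- The lift of a path starting at `v` to the path starting at `(v, r)`, together with the level
of its end point. -/
def liftPathAux (r : ZMod n) {v : V} :
    {w : V} → Quiver.Path v w →
      Σ s : ZMod n, Quiver.Path (⟨v, r⟩ : CyclicCover V n) ⟨w, s⟩
  | _, .nil => ⟨r, .nil⟩
  | _, .cons p a => ⟨(liftPathAux r p).1 + 1, (liftPathAux r p).2.cons (liftArrow a _)⟩

/-- The lift of a path of the base quiver starting at level `r`. -/
def liftPath (r : ZMod n) (p : QuiverPath V) : QuiverPath (CyclicCover V n) :=
  ⟨⟨p.1, r⟩, ⟨p.2.1, (liftPathAux r p.2.2).1⟩, (liftPathAux r p.2.2).2⟩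

/-- The linear extension `∑ kᵢ pᵢ ↦ ∑ kᵢ (lift of pᵢ starting at level r)`. -/
def lift (K : Type w) [Field K] (r : ZMod n) :
    PathAlgebra K V →ₗ[K] PathAlgebra K (CyclicCover V n) :=
  PathAlgebra.linearLift fun p => PathAlgebra.ofPath K (liftPath r p)

/-- The lifted relations `ρ'`: all lifts, at all levels, of the relations in `ρ`. -/
def liftRelations {K : Type w} [Field K] (n : ℕ) (ρ : Set (PathAlgebra K V)) :
    Set (PathAlgebra K (CyclicCover V n)) :=
  {x | ∃ y ∈ ρ, ∃ r : ZMod n, x = lift K r y}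

end

end CyclicCover

/-! ### Transfer of generation of the Yoneda algebra along a covering -/

section ExtPow

open Abelian

variable {R : Type u} [Ring R]

/-! `A'` is a Galois covering of `A` with group `ℤ/n`, and generation of the Yoneda algebra is
carried along one functor `F`. Lifting paths gives an algebra map `pull : A → A'`, sending a path to
the sum of its `n` lifts. Projecting paths gives `mat : A' → Mat_n(A)`, which puts the projection of
a path from level `r` to level `s` at entry `(s, r)`. Through `mat`, `F M = M^n` is an `A'`-module.

The functor `F` is exact, being computed coordinatewise, and it is left adjoint to restriction along
`pull`, so it preserves projectives. A path between different levels has positive length, so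
off-diagonal entries act as zero on `A/A₊`. Hence `F(A/A₊) ≅ A'/A'₊`, its coordinate projections
`p_r` are `A'`-linear, and every map `F M → F(A/A₊)` has the form `∑ F(h_r) p_r`. Dimension shifting
extends this to every `Ext^i` (`exists_ext_eq_sum`). Since `F` respects Yoneda products and
composing with `p_r` preserves the generated part, generation in degrees `0` and `1` passes from `A`
to `A'` (`extGeneratedInDegreeZeroOne`).

What remains is algebra: homogeneous relations make the length grading a genuine grading, and in
finite dimension the Jacobson radical is the positive ideal, so both notions of Koszul lead to the
same Ext statement. -/

/-- The degree-zero factor is absorbed into the last degree-one factor of each product. -/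
theorem extPow_comp_mk₀ {X : ModuleCat.{u} R} (g : X ⟶ X) {i : ℕ} {ξ : Ext.{u} X X i}
    (hξ : ξ ∈ extPow X i) : ξ.comp (Ext.mk₀ g) (add_zero i) ∈ extPow X i := by
  cases i with
  | zero => exact AddSubgroup.mem_top _
  | succ i =>
    induction hξ using AddSubgroup.closure_induction with
    | mem x hx =>
      obtain ⟨α, hα, β, rfl⟩ := hx
      refine AddSubgroup.subset_closure ⟨α, hα, β.comp (Ext.mk₀ g) (add_zero 1), ?_⟩
      rw [Ext.comp_assoc_of_third_deg_zero]
    | zero => rw [Ext.zero_comp]; exact zero_mem _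
    | add x y _ _ hx hy => rw [Ext.add_comp]; exact add_mem hx hy
    | neg x _ hx => rw [Ext.neg_comp]; exact neg_mem hx

theorem mapExactFunctor_mem_extPow {S : Type u} [Ring S] (F : ModuleCat.{u} R ⥤ ModuleCat.{u} S)
    [F.Additive] [Limits.PreservesFiniteLimits F] [Limits.PreservesFiniteColimits F]
    {X : ModuleCat.{u} R} {i : ℕ} {ξ : Ext.{u} X X i} (hξ : ξ ∈ extPow X i) :
    ξ.mapExactFunctor F ∈ extPow (F.obj X) i := by
  induction i with
  | zero => exact AddSubgroup.mem_top _
  | succ i ih =>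
    induction hξ using AddSubgroup.closure_induction with
    | mem x hx =>
      obtain ⟨α, hα, β, rfl⟩ := hx
      refine AddSubgroup.subset_closure ⟨_, ih hα, β.mapExactFunctor F, ?_⟩
      rw [Ext.mapExactFunctor_comp]
    | zero => rw [Ext.mapExactFunctor_zero]; exact zero_mem _
    | add x y _ _ hx hy => rw [Ext.mapExactFunctor_add]; exact add_mem hx hy
    | neg x _ hx =>
      have := (F.mapExtAddHom X X (i + 1)).map_neg x
      rw [Functor.mapExtAddHom_apply, Functor.mapExtAddHom_apply] at this
      rw [this]; exact neg_mem hx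

/-- Conjugation is multiplicative: `e.hom ≫ e.inv` can be inserted between consecutive factors. -/
theorem conj_mem_extPow {X Y : ModuleCat.{u} R} (e : X ≅ Y) {i : ℕ} {ξ : Ext.{u} X X i}
    (hξ : ξ ∈ extPow X i) :
    (Ext.mk₀ e.inv).comp (ξ.comp (Ext.mk₀ e.hom) (add_zero i)) (zero_add i) ∈ extPow Y i := by
  induction i with
  | zero => exact AddSubgroup.mem_top _
  | succ i ih =>
    induction hξ using AddSubgroup.closure_induction with
    | mem x hx =>
      obtain ⟨α, hα, β, rfl⟩ := hx
      refine AddSubgroup.subset_closure ⟨_, ih hα,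
        (Ext.mk₀ e.inv).comp (β.comp (Ext.mk₀ e.hom) (add_zero 1)) (zero_add 1), ?_⟩
      rw [Ext.comp_assoc (Ext.mk₀ e.inv) (α.comp (Ext.mk₀ e.hom) (add_zero i)) _ (zero_add i)
        rfl (by omega), Ext.comp_assoc_of_second_deg_zero, Ext.mk₀_comp_mk₀_assoc,
        e.hom_inv_id, Ext.mk₀_id_comp, Ext.comp_assoc_of_third_deg_zero]
    | zero => rw [Ext.zero_comp, Ext.comp_zero]; exact zero_mem _
    | add x y _ _ hx hy => rw [Ext.add_comp, Ext.comp_add]; exact add_mem hx hy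
    | neg x _ hx => rw [Ext.neg_comp, Ext.comp_neg]; exact neg_mem hx

theorem extPow_eq_top_of_iso {X Y : ModuleCat.{u} R} (e : X ≅ Y) {i : ℕ}
    (h : extPow X i = ⊤) : extPow Y i = ⊤ := by
  refine (AddSubgroup.eq_top_iff' _).2 fun ξ => ?_
  have := conj_mem_extPow e
    (ξ := (Ext.mk₀ e.hom).comp (ξ.comp (Ext.mk₀ e.inv) (add_zero i)) (zero_add i))
    (h ▸ AddSubgroup.mem_top _)
  rwa [Ext.comp_assoc_of_third_deg_zero, Ext.comp_assoc_of_third_deg_zero, Ext.mk₀_comp_mk₀,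
    e.inv_hom_id, Ext.comp_mk₀_id, Ext.mk₀_comp_mk₀_assoc, e.inv_hom_id, Ext.mk₀_id_comp] at this

/-- Suppose that `F` is exact and preserves projective objects, and that every morphism `F M ⟶ F Y`
is a sum of morphisms of the form `F h` followed by given endomorphisms of `F Y`. Then the same
holds for the elements of `Ext^i(F M, F Y)`. -/
theorem exists_ext_eq_sum {C D : Type*} [Category* C] [Category* D] [Abelian C] [Abelian D]
    [HasExt.{w} C] [HasExt.{w} D] [EnoughProjectives C] (F : C ⥤ D) [F.Additive]
    [Limits.PreservesFiniteLimits F] [Limits.PreservesFiniteColimits F]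
    [F.PreservesProjectiveObjects] {ι : Type*} [Fintype ι] {Y : C} (p : ι → (F.obj Y ⟶ F.obj Y))
    (hp : ∀ (M : C) (g : F.obj M ⟶ F.obj Y), ∃ h : ι → (M ⟶ Y), g = ∑ r, F.map (h r) ≫ p r)
    (i : ℕ) (M : C) (ξ : Ext.{w} (F.obj M) (F.obj Y) i) :
    ∃ ζ : ι → Ext.{w} M Y i, ξ = ∑ r, ((ζ r).mapExactFunctor F).comp
      (Ext.mk₀ (p r)) (add_zero i) := by
  induction i generalizing M with
  | zero =>
    obtain ⟨g, rfl⟩ := (Ext.mk₀_bijective _ _).2 ξ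
    obtain ⟨h, rfl⟩ := hp M g
    refine ⟨fun r => Ext.mk₀ (h r), ?_⟩
    simp_rw [Ext.mapExactFunctor_mk₀, Ext.mk₀_comp_mk₀]
    rw [← Ext.mk₀_sum]
  | succ i ih =>
    -- Dimension shift along `0 → ΩM → P → M → 0`. As `F P` is projective, `ξ` is the class of the
    -- image sequence times an element of degree `i` on `F(ΩM)`, and that class is itself the image
    -- under `F` of an extension class. This is why `M` varies in the induction.
    let S := ShortComplex.mk _ _ (Limits.kernel.condition (Projective.π M))
    have hS : S.ShortExact :=
      { exact := ShortComplex.exact_of_f_is_kernel _ (Limits.kernelIsKernel S.g) }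
    have : Projective (S.map F).X₂ :=
      F.projective_obj_of_projective (X := Projective.over M) inferInstance
    obtain ⟨ξ', rfl⟩ := Ext.contravariant_sequence_exact₃ (hS.map_of_exact F) _ ξ
      (Ext.eq_zero_of_projective _) (add_comm 1 i)
    obtain ⟨ζ, rfl⟩ := ih (Limits.kernel (Projective.π M)) ξ'
    refine ⟨fun r => hS.extClass.comp (ζ r) (add_comm 1 i), ?_⟩
    refine (Ext.comp_sum _ _ _).trans (Finset.sum_congr rfl fun r _ => ?_)
    rw [Ext.mapExactFunctor_comp, Ext.mapExactFunctor_extClass]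
    exact (Ext.comp_assoc_of_third_deg_zero _ _ _ _).symm

theorem extPow_obj_eq_top {S : Type u} [Ring S] (F : ModuleCat.{u} R ⥤ ModuleCat.{u} S)
    [F.Additive] [Limits.PreservesFiniteLimits F] [Limits.PreservesFiniteColimits F]
    [F.PreservesProjectiveObjects] {ι : Type*} [Fintype ι] {Y : ModuleCat.{u} R}
    (p : ι → (F.obj Y ⟶ F.obj Y))
    (hp : ∀ (M : ModuleCat.{u} R) (g : F.obj M ⟶ F.obj Y),
      ∃ h : ι → (M ⟶ Y), g = ∑ r, F.map (h r) ≫ p r)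
    {i : ℕ} (h : extPow Y i = ⊤) : extPow (F.obj Y) i = ⊤ := by
  refine (AddSubgroup.eq_top_iff' _).2 fun ξ => ?_
  obtain ⟨ζ, rfl⟩ := exists_ext_eq_sum F p hp i Y ξ
  exact sum_mem fun r _ => extPow_comp_mk₀ _
    (mapExactFunctor_mem_extPow _ (h ▸ AddSubgroup.mem_top (ζ r)))

end ExtPow

/-- Ring-theoretic data of a Galois covering `A'` of `A` with fibre `ι`: the pull-back
`A → A'`, the matrix representation of `A'` over `A`, and the complete set of idempotents of `A'`
cutting out the fibres. -/
structure RingCovering (ι : Type) [Fintype ι] [DecidableEq ι] (A A' : Type u) [Ring A] [Ring A']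
    where
  /-- pull-back of elements of `A` -/
  pull : A →+* A'
  /-- matrix representation -/
  mat : A' →+* Matrix ι ι A
  /-- the idempotents -/
  idem : ι → A'
  sum_idem : ∑ r, idem r = 1
  mat_idem : ∀ r, mat (idem r) = Matrix.single r r 1
  -- This makes the diagonal `M → M^ι` semilinear along `pull`; the next field makes the extension
  -- of a semilinear map from the diagonal to `M^ι` linear over `A'`.
  sum_mat_pull : ∀ a s, ∑ r, mat (pull a) s r = a
  sum_idem_pull : ∀ x r, ∑ s, idem s * pull (mat x s r) = x * idem r

/-! ### The functor `M ↦ M^ι` of a ring covering -/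

namespace RingCovering

open Abelian Matrix.Module

variable {ι : Type} [Fintype ι] [DecidableEq ι] {A A' : Type u} [Ring A] [Ring A']
  (D : RingCovering ι A A')

/-- The `A'`-module `M^ι` attached to an `A`-module `M`. -/
def Fiber (_ : RingCovering ι A A') (M : Type u) : Type u := ι → M

section Fiber

variable {M : Type u} [AddCommGroup M]

omit [AddCommGroup M] in
@[ext]
theorem Fiber.ext {f g : D.Fiber M} (h : ∀ r, f r = g r) : f = g :=
  funext h

instance : AddCommGroup (D.Fiber M) :=
  inferInstanceAs (AddCommGroup (ι → M))

theorem add_apply (f g : D.Fiber M) (s : ι) : (f + g) s = f s + g s :=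
  rfl

theorem sum_apply {κ : Type*} (t : Finset κ) (f : κ → D.Fiber M) (s : ι) :
    (∑ k ∈ t, f k) s = ∑ k ∈ t, f k s :=
  Finset.sum_apply s t f

variable (M) in
/-- The diagonal `M → M^ι`. -/
def diag : M →+ D.Fiber M where
  toFun m := fun _ => m
  map_zero' := rfl
  map_add' _ _ := rfl

theorem diag_apply (m : M) (r : ι) : D.diag M m r = m :=
  rfl

variable [Module A M]

noncomputable instance : Module A' (D.Fiber M) :=
  Module.compHom (ι → M) D.mat

theorem smul_apply (x : A') (f : D.Fiber M) (s : ι) :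
    (x • f) s = ∑ r, D.mat x s r • f r :=
  rfl

theorem idem_smul_apply (f : D.Fiber M) (r s : ι) :
    (D.idem r • f) s = if s = r then f r else 0 := by
  rw [smul_apply, D.mat_idem]
  split_ifs with h
  · subst h
    refine (Fintype.sum_eq_single s fun t ht => ?_).trans
      ((congrArg (· • f s) (Matrix.single_apply_same s s 1)).trans (one_smul A _))
    exact (congrArg (· • f t) (Matrix.single_apply_of_ne _ _ _ _ _ (by tauto))).trans (zero_smul A _)
  · exact Finset.sum_eq_zero fun t _ =>
      (congrArg (· • f t) (Matrix.single_apply_of_ne _ _ _ _ _ (by tauto))).trans (zero_smul A _)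

/-- The diagonal generates `M^ι` over `A'`, so a linear map out of `M^ι` is determined by its
restriction to the diagonal. -/
theorem sum_idem_smul_diag (f : D.Fiber M) : ∑ r, D.idem r • D.diag M (f r) = f := by
  ext s
  simp only [sum_apply, idem_smul_apply, diag_apply]
  exact (Finset.sum_ite_eq _ s fun r => f r).trans (if_pos (Finset.mem_univ s))

theorem pull_smul_diag (a : A) (m : M) : D.pull a • D.diag M m = D.diag M (a • m) := by
  ext s
  simp only [smul_apply, diag_apply]
  rw [← Finset.sum_smul, D.sum_mat_pull]

variable {N : Type u} [AddCommGroup N] [Module A' N]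

/-- The `A'`-linear map `M^ι → N` corresponding to an `A`-linear map `M → N`. -/
def ofPull (h : M →+ N) (hh : ∀ (a : A) (m : M), h (a • m) = D.pull a • h m) :
    D.Fiber M →ₗ[A'] N where
  toFun f := ∑ r, D.idem r • h (f r)
  map_add' f g := by simp [add_apply, Finset.sum_add_distrib]
  map_smul' x f := by
    simp only [smul_apply, map_sum, hh, RingHom.id_apply, Finset.smul_sum]
    -- After the swap, the coefficient of `h (f r)` is `∑ s, idem s * pull (mat x s r)`, which is `x
    -- * idem r`.
    rw [Finset.sum_comm]
    refine Finset.sum_congr rfl fun r _ => ?_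
    simp_rw [← mul_smul]
    rw [← Finset.sum_smul, D.sum_idem_pull]

theorem map_smul_diag (g : D.Fiber M →ₗ[A'] N) (a : A) (m : M) :
    g (D.diag M (a • m)) = D.pull a • g (D.diag M m) := by
  rw [← pull_smul_diag, map_smul]

theorem sum_idem_smul_map_diag (g : D.Fiber M →ₗ[A'] N) (f : D.Fiber M) :
    ∑ r, D.idem r • g (D.diag M (f r)) = g f := by
  conv_rhs => rw [← D.sum_idem_smul_diag f, map_sum]
  exact Finset.sum_congr rfl fun r _ => (map_smul g _ _).symm

/-- The functoriality of `M ↦ M^ι`. -/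
def fiberMap {M' : Type u} [AddCommGroup M'] [Module A M'] (h : M →ₗ[A] M') :
    D.Fiber M →ₗ[A'] D.Fiber M' where
  toFun f := fun r => h (f r)
  map_add' f g := Fiber.ext D fun r => map_add h (f r) (g r)
  map_smul' x f := Fiber.ext D fun r => by
    change h ((x • f) r) = ∑ s, D.mat x r s • h (f s)
    simp only [smul_apply, map_sum, map_smul]

end Fiber

/-- The functor `M ↦ M^ι` from `A`-modules to `A'`-modules. -/
noncomputable def functor : ModuleCat.{u} A ⥤ ModuleCat.{u} A' where
  obj M := ModuleCat.of A' (D.Fiber M)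
  map h := ModuleCat.ofHom (D.fiberMap h.hom)

instance : D.functor.Additive where
  map_add := rfl

theorem functor_map_exact (S : ShortComplex (ModuleCat.{u} A)) (hS : S.Exact) :
    (S.map D.functor).Exact := by
  rw [ShortComplex.ShortExact.moduleCat_exact_iff_function_exact] at hS ⊢
  intro f
  constructor
  · intro hf
    choose g hg using fun r => (hS (f r)).1 (congrFun hf r)
    exact ⟨g, funext hg⟩
  · rintro ⟨g, rfl⟩
    exact funext fun r => (hS _).2 ⟨g r, rfl⟩

theorem functor_exact :
    Limits.PreservesFiniteLimits D.functor ∧ Limits.PreservesFiniteColimits D.functor :=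
  ((Functor.exact_tfae D.functor).out 1 3).1 D.functor_map_exact

instance : Limits.PreservesFiniteLimits D.functor :=
  D.functor_exact.1

instance : Limits.PreservesFiniteColimits D.functor :=
  D.functor_exact.2

/-- Left adjointness to restriction along `pull`, which keeps surjections: a map out of `P^ι` is
restricted to the diagonal, lifted over `A`, and extended back by `ofPull`. -/
theorem projective_fiber {P : Type u} [AddCommGroup P] [Module A P] [Module.Projective A P] :
    Module.Projective A' (D.Fiber P) := by
  refine Module.Projective.of_lifting_property fun {E X} _ _ _ _ e g he => ?_
  let := Module.compHom E D.pull
  let := Module.compHom X D.pull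
  let e' : E →ₗ[A] X := { (e : E →+ X) with map_smul' := fun a m => map_smul e (D.pull a) m }
  let k : P →ₗ[A] X :=
    { (g : D.Fiber P →+ X).comp (D.diag P) with map_smul' := D.map_smul_diag g }
  obtain ⟨l, hl⟩ := Module.projective_lifting_property e' k he
  refine ⟨D.ofPull (l : P →+ E) (map_smul l), LinearMap.ext fun f => ?_⟩
  rw [← D.sum_idem_smul_map_diag g f]
  refine (map_sum e _ _).trans (Finset.sum_congr rfl fun r _ => ?_)
  rw [map_smul]
  exact congrArg (D.idem r • ·) (LinearMap.congr_fun hl (f r))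

instance : D.functor.PreservesProjectiveObjects where
  projective_obj {P} hP := by
    have := P.projective_of_module_projective
    have := D.projective_fiber (P := P)
    exact (IsProjective.iff_projective _).1 this

/-! ### Linear maps into `X^ι` when off-diagonal entries act as zero -/

section Semisimple

variable {X : Type u} [AddCommGroup X] [Module A X]
  (hX : ∀ (x : A') (s r : ι), s ≠ r → ∀ m : X, D.mat x s r • m = 0)

include hX

theorem smul_apply_of_offDiag (x : A') (f : D.Fiber X) (s : ι) :
    (x • f) s = D.mat x s s • f s := by
  rw [smul_apply]
  exact Fintype.sum_eq_single s fun r hr => hX x s r hr.symm _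

/-- Row `s` of `mat (pull a)` sums to `a`, and only its diagonal entry acts on `X`. -/
theorem mat_pull_smul (a : A) (s : ι) (m : X) : D.mat (D.pull a) s s • m = a • m :=
  (D.smul_apply_of_offDiag hX (D.pull a) (D.diag X m) s).symm.trans
    (by rw [pull_smul_diag, diag_apply])

/-- If the off-diagonal matrix coefficients annihilate `X`, then the projection of `X^ι` to a factor
is `A'`-linear. -/
noncomputable def factorProj (r : ι) : D.Fiber X →ₗ[A'] D.Fiber X where
  toFun f := D.idem r • f
  map_add' := smul_add _
  map_smul' x f := Fiber.ext D fun s => by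
    rw [RingHom.id_apply, D.smul_apply_of_offDiag hX x, idem_smul_apply, idem_smul_apply]
    split_ifs with h
    · rw [D.smul_apply_of_offDiag hX x, h]
    · rw [smul_zero]

/-- The component of an `A'`-linear map `M^ι → X^ι` at `r`. -/
noncomputable def component {M : Type u} [AddCommGroup M] [Module A M] (g : D.Fiber M →ₗ[A'] D.Fiber X)
    (r : ι) : M →ₗ[A] X where
  toFun m := g (D.diag M m) r
  map_add' m m' := by rw [map_add, map_add, add_apply]
  map_smul' a m := by
    rw [map_smul_diag, D.smul_apply_of_offDiag hX, D.mat_pull_smul hX, RingHom.id_apply]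

/-- Expanding `f` over the diagonal gives `g f = ∑ r, idem r • g (diag (f r))`; the `r`-th term sees
only coordinate `r` of `g ∘ diag`, which is `A`-linear. This supplies the hypothesis of
`extPow_obj_eq_top`. -/
theorem eq_sum_factorProj {M : Type u} [AddCommGroup M] [Module A M]
    (g : D.Fiber M →ₗ[A'] D.Fiber X) :
    g = ∑ r, D.factorProj hX r ∘ₗ D.fiberMap (D.component hX g r) := by
  refine LinearMap.ext fun f => ?_
  rw [← D.sum_idem_smul_map_diag g f, LinearMap.sum_apply]
  refine Finset.sum_congr rfl fun r _ => Fiber.ext D fun s => ?_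
  simp only [LinearMap.comp_apply, factorProj, LinearMap.coe_mk, AddHom.coe_mk, idem_smul_apply]
  rfl

theorem extPow_functor_eq_top {i : ℕ} (h : extPow (ModuleCat.of A X) i = ⊤) :
    extPow (D.functor.obj (ModuleCat.of A X)) i = ⊤ := by
  refine extPow_obj_eq_top D.functor (fun r => ModuleCat.ofHom (D.factorProj hX r))
    (fun M g => ⟨fun r => ModuleCat.ofHom (D.component hX g.hom r), ?_⟩) h
  ext1
  rw [ModuleCat.hom_sum]
  exact D.eq_sum_factorProj hX g.hom

end Semisimple

/-! ### Identification of `(A/I)^ι` with `A'/I'` -/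

section Ideals

variable (I : Ideal A) [I.IsTwoSided] (I' : Ideal A')
  (hoff : ∀ (x : A') (s r : ι), s ≠ r → D.mat x s r ∈ I)
  (hpull : ∀ a ∈ I, D.pull a ∈ I') (hmat : ∀ x ∈ I', ∀ s, D.mat x s s ∈ I)

include hoff in
theorem mat_smul_quotient (x : A') (s r : ι) (h : s ≠ r) (m : A ⧸ I) : D.mat x s r • m = 0 := by
  obtain ⟨m, rfl⟩ := Ideal.Quotient.mk_surjective m
  exact Ideal.Quotient.eq_zero_iff_mem.2 (I.mul_mem_right m (hoff x s r h))

include hoff in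
theorem smul_diag_one_apply (x : A') (s : ι) :
    (x • D.diag (A ⧸ I) (Submodule.Quotient.mk 1)) s = Submodule.Quotient.mk (D.mat x s s) := by
  rw [D.smul_apply_of_offDiag (D.mat_smul_quotient I hoff), diag_apply,
    ← Submodule.Quotient.mk_smul, smul_eq_mul, mul_one]

-- An element kills the diagonal of `1` exactly when its diagonal entries lie in `I`. All its
-- entries then lie in `I`, and rebuilding the element from its entries by `sum_idem_pull` puts it
-- in `I'`.
include hoff hpull hmat in
theorem ker_toSpanSingleton :
    LinearMap.ker (LinearMap.toSpanSingleton A' (D.Fiber (A ⧸ I))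
      (D.diag (A ⧸ I) (Submodule.Quotient.mk 1))) = I' := by
  ext x
  rw [LinearMap.mem_ker, LinearMap.toSpanSingleton_apply]
  have key : x • D.diag (A ⧸ I) (Submodule.Quotient.mk 1) = 0 ↔ ∀ s, D.mat x s s ∈ I := by
    constructor
    · intro h s
      rw [← Submodule.Quotient.mk_eq_zero I, ← D.smul_diag_one_apply I hoff x s, h]
      rfl
    · intro h
      ext s
      rw [D.smul_diag_one_apply I hoff x s, (Submodule.Quotient.mk_eq_zero I).2 (h s)]
      rfl
  rw [key]
  refine ⟨fun h => ?_, hmat x⟩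
  rw [← mul_one x, ← D.sum_idem, Finset.mul_sum]
  refine sum_mem fun r _ => ?_
  rw [← D.sum_idem_pull]
  refine sum_mem fun s _ => I'.mul_mem_left _ (hpull _ ?_)
  by_cases hsr : s = r
  · exact hsr ▸ h s
  · exact hoff x s r hsr

omit [I.IsTwoSided] in
theorem toSpanSingleton_surjective :
    Function.Surjective (LinearMap.toSpanSingleton A' (D.Fiber (A ⧸ I))
      (D.diag (A ⧸ I) (Submodule.Quotient.mk 1))) := by
  intro f
  choose a ha using fun r => Submodule.Quotient.mk_surjective I (f r)
  refine ⟨∑ r, D.idem r * D.pull (a r), ?_⟩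
  rw [LinearMap.toSpanSingleton_apply, Finset.sum_smul]
  conv_rhs => rw [← D.sum_idem_smul_diag f]
  refine Finset.sum_congr rfl fun r _ => ?_
  rw [mul_smul, pull_smul_diag, ← Submodule.Quotient.mk_smul, smul_eq_mul, mul_one, ha]

include hoff hpull hmat in
/-- Generation of the Yoneda algebra in degrees `0` and `1` passes to coverings. -/
theorem extGeneratedInDegreeZeroOne (h : ExtGeneratedInDegreeZeroOne A (A ⧸ I)) :
    ExtGeneratedInDegreeZeroOne A' (A' ⧸ I') := by
  intro i hi
  let e : (A' ⧸ I') ≃ₗ[A'] D.Fiber (A ⧸ I) :=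
    (Submodule.quotEquivOfEq _ _ (D.ker_toSpanSingleton I I' hoff hpull hmat).symm).trans
      (LinearMap.quotKerEquivOfSurjective _ (D.toSpanSingleton_surjective I))
  have e' : D.functor.obj (ModuleCat.of A (A ⧸ I)) ≅ ModuleCat.of A' (A' ⧸ I') :=
    e.symm.toModuleIso
  exact extPow_eq_top_of_iso e'
    (D.extPow_functor_eq_top (D.mat_smul_quotient I hoff) (h i hi))

end Ideals

end RingCovering

/-! ### Path algebras and their quotients -/

/-- A submodule closed under multiplication on which an algebra homomorphism `ε` is bijective is a
subalgebra isomorphic to the target of `ε`. -/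
theorem exists_subalgebra_equiv {K B C : Type*} [Field K] [Ring B] [Ring C] [Algebra K B]
    [Algebra K C] (P : Submodule K B) (hone : 1 ∈ P) (hmul : ∀ x ∈ P, ∀ y ∈ P, x * y ∈ P)
    (ε : B →ₐ[K] C) (hinj : ∀ x ∈ P, ε x = 0 → x = 0) (hsurj : ∀ c, ∃ x ∈ P, ε x = c) :
    ∃ S : Subalgebra K B, Subalgebra.toSubmodule S = P ∧ Nonempty (S ≃ₐ[K] C) := by
  refine ⟨P.toSubalgebra hone fun x y hx hy => hmul x hx y hy,
    Submodule.toSubalgebra_toSubmodule P _ _,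
    ⟨AlgEquiv.ofBijective (ε.comp (Subalgebra.val _)) ⟨?_, fun c => ?_⟩⟩⟩
  · exact (injective_iff_map_eq_zero _).2 fun x hx => Subtype.ext (hinj x x.2 hx)
  · obtain ⟨x, hx, hc⟩ := hsurj c
    exact ⟨⟨x, hx⟩, hc⟩

namespace PathAlgebra

variable {K : Type w} [Field K] {V : Type u} [Quiver.{v} V]

theorem induction_on {P : PathAlgebra K V → Prop} (x : PathAlgebra K V)
    (path : ∀ p, P (ofPath K p)) (zero : P 0) (add : ∀ x y, P x → P y → P (x + y))
    (smul : ∀ (c : K) x, P x → P (c • x)) : P x := by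
  let S : Submodule K (PathAlgebra K V) :=
    { carrier := {x | P x}
      add_mem' := fun {x y} => add x y
      zero_mem' := zero
      smul_mem' := smul }
  -- The quotient map by the subspace where `P` holds kills every path, hence everything.
  have h : S.mkQ = 0 := lin_ext fun p => (Submodule.Quotient.mk_eq_zero S).2 (path p)
  exact (Submodule.Quotient.mk_eq_zero S).1 (LinearMap.congr_fun h x)

theorem ofPath_mem_lengthPart (p : QuiverPath V) : ofPath K p ∈ lengthPart K V p.2.2.length :=
  Submodule.subset_span ⟨p, rfl, rfl⟩

theorem lengthPart_le_iff {i : ℕ} {S : Submodule K (PathAlgebra K V)} :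
    lengthPart K V i ≤ S ↔ ∀ p : QuiverPath V, p.2.2.length = i → ofPath K p ∈ S := by
  rw [lengthPart, Submodule.span_le]
  exact ⟨fun h p hp => h ⟨p, hp, rfl⟩, fun h _ ⟨p, hp, hx⟩ => hx ▸ h p hp⟩

variable [Fintype V]

section Lift

variable {B : Type*} [Ring B] [Algebra K B] (f : QuiverPath V → B)
  (hone : ∑ a : V, f ⟨a, a, .nil⟩ = 1)
  (hcomp : ∀ (a b c : V) (q : Quiver.Path a b) (p : Quiver.Path b c),
    f ⟨b, c, p⟩ * f ⟨a, b, q⟩ = f ⟨a, c, q.comp p⟩)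
  (hne : ∀ p q : QuiverPath V, p.1 ≠ q.2.1 → f p * f q = 0)

include hone hcomp hne in
/-- The universal property of the path algebra. -/
theorem exists_algHom : ∃ φ : PathAlgebra K V →ₐ[K] B, ∀ p, φ (ofPath K p) = f p := by
  refine ⟨AlgHom.ofLinearMap (linearLift f) ?_ ?_, fun p => linearLift_ofPath f p⟩
  · rw [one_def, map_sum, ← hone]
    exact Finset.sum_congr rfl fun a _ => linearLift_ofPath f _
  · have h : (mulLin K V).compr₂ (linearLift f) =
        (LinearMap.mul K B).compl₁₂ (linearLift f) (linearLift f) := by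
      refine lin_ext fun p => lin_ext fun q => ?_
      rw [LinearMap.compr₂_apply, LinearMap.compl₁₂_apply, linearLift_ofPath, linearLift_ofPath,
        LinearMap.mul_apply', ← mul_def, ofPath_mul_ofPath]
      obtain ⟨b, c, p⟩ := p
      obtain ⟨a, b', q⟩ := q
      by_cases hb : b = b'
      · subst hb
        rw [mulPath_of_eq, linearLift_ofPath, hcomp]
      · rw [mulPath_of_ne (by exact hb), map_zero, hne _ _ (by exact hb)]
    exact fun x y => LinearMap.congr_fun₂ h x y

end Lift

theorem one_mem_lengthPart : (1 : PathAlgebra K V) ∈ lengthPart K V 0 := by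
  rw [one_def]
  exact sum_mem fun a _ => ofPath_mem_lengthPart ⟨a, a, .nil⟩

theorem lengthPart_mul_le (i j : ℕ) :
    lengthPart K V i * lengthPart K V j ≤ lengthPart K V (i + j) := by
  unfold lengthPart
  rw [Submodule.span_mul_span, Submodule.span_le]
  rintro _ ⟨_, ⟨⟨b, c, p⟩, rfl, rfl⟩, _, ⟨⟨a, b', q⟩, rfl, rfl⟩, rfl⟩
  dsimp only
  rw [ofPath_mul_ofPath]
  by_cases hb : b = b'
  · subst hb
    rw [mulPath_of_eq]
    exact Submodule.subset_span ⟨_, by simp [add_comm], rfl⟩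
  · rw [mulPath_of_ne (by exact hb)]
    exact zero_mem _

theorem lengthPart_succ (i : ℕ) :
    lengthPart K V (i + 1) = lengthPart K V 1 * lengthPart K V i := by
  refine le_antisymm (lengthPart_le_iff.2 ?_) (add_comm i 1 ▸ lengthPart_mul_le 1 i)
  rintro ⟨a, c, p⟩ hp
  cases p with
  | nil => simp at hp
  | cons q e =>
    have : ofPath K ⟨a, c, q.cons e⟩ = ofPath K ⟨_, c, e.toPath⟩ * ofPath K ⟨a, _, q⟩ := by
      rw [ofPath_mul_ofPath, mulPath_of_eq, Quiver.Path.comp_toPath_eq_cons]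
    rw [this]
    refine Submodule.mul_mem_mul (ofPath_mem_lengthPart ⟨_, c, e.toPath⟩) ?_
    obtain rfl : q.length = i := by simpa using hp
    exact ofPath_mem_lengthPart ⟨a, _, q⟩

theorem lengthPart_succ_eq_pow (i : ℕ) : lengthPart K V (i + 1) = lengthPart K V 1 ^ (i + 1) := by
  induction i with
  | zero => rw [zero_add, pow_one]
  | succ i ih => rw [lengthPart_succ, ih, ← pow_succ']

theorem lengthPart_zero_fg : (lengthPart K V 0).FG := by
  refine Submodule.fg_span ((Set.finite_range fun a : V => ofPath K ⟨a, a, .nil⟩).subset ?_)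
  rintro _ ⟨⟨a, b, p⟩, hp, rfl⟩
  obtain rfl := Quiver.Path.eq_of_length_zero p hp
  exact ⟨a, by rw [Quiver.Path.eq_nil_of_length_zero p hp]⟩

theorem lengthPart_one_fg [∀ a b : V, Finite (a ⟶ b)] : (lengthPart K V 1).FG := by
  refine Submodule.fg_span ((Set.finite_range fun e : Σ a b : V, a ⟶ b =>
    ofPath K ⟨e.1, e.2.1, e.2.2.toPath⟩).subset ?_)
  rintro _ ⟨⟨a, b, p⟩, hp, rfl⟩
  cases p with
  | nil => simp at hp
  | cons q e =>
    have hq : q.length = 0 := by simpa using hp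
    obtain rfl := Quiver.Path.eq_of_length_zero q hq
    obtain rfl := Quiver.Path.eq_nil_of_length_zero q hq
    exact ⟨⟨a, b, e⟩, rfl⟩

end PathAlgebra

/-! ### Quadratic quotients of path algebras: grading, augmentation, radical -/

namespace QuiverAlgebra

open PathAlgebra

variable {K : Type w} [Field K] {V : Type u} [Quiver.{v} V] [Fintype V]
  (ρ : Set (PathAlgebra K V))

/-- The quotient map `K Q → K Q / ⟨ρ⟩`. -/
noncomputable def proj : PathAlgebra K V →ₐ[K] QuiverAlgebra ρ :=
  Ideal.Quotient.mkₐ K (relationIdeal ρ)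

theorem proj_surjective : Function.Surjective (proj ρ) :=
  Ideal.Quotient.mkₐ_surjective K _

variable {ρ} in
theorem proj_eq_zero_of_mem {x : PathAlgebra K V} (hx : x ∈ ρ) : proj ρ x = 0 :=
  Ideal.Quotient.eq_zero_iff_mem.2 (TwoSidedIdeal.subset_span hx)

theorem exists_algHom {B : Type*} [Ring B] [Algebra K B] (φ : PathAlgebra K V →ₐ[K] B)
    (h : ∀ x ∈ ρ, φ x = 0) : ∃ ψ : QuiverAlgebra ρ →ₐ[K] B, ∀ x, ψ (proj ρ x) = φ x := by
  have hle : TwoSidedIdeal.span ρ ≤ TwoSidedIdeal.ker φ :=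
    TwoSidedIdeal.span_le.2 fun x hx => (TwoSidedIdeal.mem_ker _).2 (h x hx)
  exact ⟨Ideal.Quotient.liftₐ _ φ fun x hx => (TwoSidedIdeal.mem_ker _).1 (hle hx), fun x => rfl⟩

variable {ρ}

theorem induction_on {P : QuiverAlgebra ρ → Prop} (x : QuiverAlgebra ρ)
    (path : ∀ p, P (proj ρ (ofPath K p))) (zero : P 0) (add : ∀ x y, P x → P y → P (x + y))
    (smul : ∀ (c : K) x, P x → P (c • x)) : P x := by
  obtain ⟨x, rfl⟩ := proj_surjective ρ x
  refine PathAlgebra.induction_on (P := fun x => P (proj ρ x)) x path (by rwa [map_zero]) (fun x y hx hy => ?_)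
    (fun c x hx => ?_)
  · rw [map_add]; exact add _ _ hx hy
  · rw [map_smul]; exact smul _ _ hx

theorem proj_mem_lengthGrading (p : QuiverPath V) :
    proj ρ (ofPath K p) ∈ lengthGrading ρ p.2.2.length :=
  Submodule.mem_map_of_mem (ofPath_mem_lengthPart p)

theorem lengthGrading_le_iff {i : ℕ} {S : Submodule K (QuiverAlgebra ρ)} :
    lengthGrading ρ i ≤ S ↔ ∀ p : QuiverPath V, p.2.2.length = i → proj ρ (ofPath K p) ∈ S :=
  Submodule.map_le_iff_le_comap.trans lengthPart_le_iff

theorem lengthGrading_gradedMonoid : SetLike.GradedMonoid (lengthGrading ρ) where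
  one_mem := ⟨1, one_mem_lengthPart, map_one (proj ρ)⟩
  mul_mem i j _ _ := by
    rintro ⟨x, hx, rfl⟩ ⟨y, hy, rfl⟩
    exact ⟨x * y, lengthPart_mul_le i j (Submodule.mul_mem_mul hx hy), map_mul (proj ρ) x y⟩

theorem lengthGrading_eq_pow {i : ℕ} (hi : 2 ≤ i) : lengthGrading ρ i = lengthGrading ρ 1 ^ i := by
  obtain ⟨i, rfl⟩ := Nat.exists_eq_succ_of_ne_zero (by omega : i ≠ 0)
  unfold lengthGrading
  rw [lengthPart_succ_eq_pow]
  exact Submodule.map_pow _ (proj ρ) _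

variable (hρ : ∀ x ∈ ρ, x ∈ lengthPart K V 2)

include hρ

/-- The coaction `x ↦ x T^i` for `x` of degree `i`. -/
theorem exists_coaction : ∃ δ : QuiverAlgebra ρ →ₐ[K] Polynomial (QuiverAlgebra ρ),
    ∀ i, ∀ x ∈ lengthGrading ρ i, δ x = Polynomial.monomial i x := by
  obtain ⟨φ, hφ⟩ := PathAlgebra.exists_algHom (K := K)
    (fun p : QuiverPath V => Polynomial.monomial p.2.2.length (proj ρ (ofPath K p)))
    (by
      simp only [Quiver.Path.length_nil]
      rw [← map_sum, ← map_sum, ← one_def, map_one]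
      rfl)
    (fun a b c q p => by
      rw [Polynomial.monomial_mul_monomial, ← map_mul, ofPath_mul_ofPath, mulPath_of_eq,
        Quiver.Path.length_comp, add_comm])
    (fun p q h => by
      rw [Polynomial.monomial_mul_monomial, ← map_mul, ofPath_mul_ofPath, mulPath_of_ne h,
        map_zero, map_zero])
  have h (i : ℕ) (x) (hx : x ∈ lengthPart K V i) : φ x = Polynomial.monomial i (proj ρ x) := by
    refine lengthPart_le_iff (S := LinearMap.eqLocus φ.toLinearMap
      ((Polynomial.monomial i).restrictScalars K ∘ₗ (proj ρ).toLinearMap)) |>.2 ?_ hx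
    rintro p rfl
    exact hφ p
  -- Homogeneity is what lets the coaction descend: a relation goes to `T^2` times its own class,
  -- which is zero.
  obtain ⟨δ, hδ⟩ := exists_algHom ρ φ fun x hx => by
    rw [h 2 x (hρ x hx), proj_eq_zero_of_mem hx, map_zero]
  refine ⟨δ, ?_⟩
  rintro i _ ⟨x, hx, rfl⟩
  exact (hδ x).trans (h i x hx)

/-- The coefficient of `T^j` in the coaction recovers the component of degree `j`, so decompositions
are unique; they exist because paths span. -/
theorem lengthGrading_isInternal : DirectSum.IsInternal (lengthGrading ρ) := by
  classical
  obtain ⟨δ, hδ⟩ := exists_coaction hρ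
  constructor
  · refine (injective_iff_map_eq_zero _).2 fun x hx => ?_
    have h (x : DirectSum ℕ fun i => lengthGrading ρ i) (j : ℕ) :
        (δ (DirectSum.coeAddMonoidHom (lengthGrading ρ) x)).coeff j = x j := by
      induction x using DirectSum.induction_on with
      | zero => simp
      | of i x =>
        rw [DirectSum.coeAddMonoidHom_of, hδ i x x.2, Polynomial.coeff_monomial,
          DirectSum.coe_of_apply]
        split_ifs <;> rfl
      | add x y hx hy => rw [map_add, map_add, Polynomial.coeff_add, hx, hy]; rfl
    ext j
    rw [← h x j, hx]
    simp
  · intro x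
    induction x using induction_on with
    | path p => exact ⟨DirectSum.of (fun i => lengthGrading ρ i) _ ⟨_, proj_mem_lengthGrading p⟩,
        DirectSum.coeAddMonoidHom_of _ _ _⟩
    | zero => exact ⟨0, map_zero _⟩
    | add x y hx hy =>
      obtain ⟨x, rfl⟩ := hx
      obtain ⟨y, rfl⟩ := hy
      exact ⟨x + y, map_add _ _ _⟩
    | smul c x hx =>
      obtain ⟨x, rfl⟩ := hx
      exact ⟨c • x, map_smul (DirectSum.coeLinearMap (lengthGrading ρ)) c x⟩

/-- The augmentation `K Q / ⟨ρ⟩ → K^V`. -/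
theorem exists_augmentation [DecidableEq V] : ∃ ε : QuiverAlgebra ρ →ₐ[K] (V → K),
    (∀ a, ε (proj ρ (ofPath K ⟨a, a, .nil⟩)) = Pi.single a 1) ∧
    ∀ i, 1 ≤ i → ∀ x ∈ lengthGrading ρ i, ε x = 0 := by
  obtain ⟨φ, hφ⟩ := PathAlgebra.exists_algHom (K := K)
    (fun p : QuiverPath V => if p.2.2.length = 0 then (Pi.single p.1 1 : V → K) else 0)
    (by
      simp only [Quiver.Path.length_nil, if_true]
      exact Finset.univ_sum_single (1 : V → K))
    (fun a b c q p => by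
      cases q with
      | nil =>
        simp only [Quiver.Path.length_nil, if_true, Quiver.Path.nil_comp]
        split_ifs
        · rw [← Pi.single_mul, one_mul]
        · rw [zero_mul]
      | cons q e => simp)
    (fun p q h => by
      obtain ⟨b, c, p⟩ := p
      obtain ⟨a, b', q⟩ := q
      dsimp only at h ⊢
      split_ifs with hp hq
      · obtain rfl := Quiver.Path.eq_of_length_zero q hq
        ext v
        by_cases hv : v = b
        · subst hv; simp [h]
        · simp [hv]
      all_goals simp)
  have h (i : ℕ) (hi : 1 ≤ i) (x) (hx : x ∈ lengthPart K V i) : φ x = 0 := by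
    refine lengthPart_le_iff (S := LinearMap.ker φ.toLinearMap) |>.2 ?_ hx
    rintro p rfl
    exact (hφ p).trans (if_neg (by omega))
  obtain ⟨ε, hε⟩ := exists_algHom ρ φ fun x hx => h 2 (by omega) x (hρ x hx)
  refine ⟨ε, fun a => ?_, ?_⟩
  · rw [hε, hφ]; rfl
  · rintro i hi _ ⟨x, hx, rfl⟩
    exact (hε x).trans (h i hi x hx)

omit hρ in
theorem lengthGrading_zero_le {S : Submodule K (QuiverAlgebra ρ)} :
    lengthGrading ρ 0 ≤ S ↔ ∀ a : V, proj ρ (ofPath K ⟨a, a, .nil⟩) ∈ S := by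
  rw [lengthGrading_le_iff]
  refine ⟨fun h a => h _ rfl, ?_⟩
  rintro h ⟨a, b, p⟩ hp
  obtain rfl := Quiver.Path.eq_of_length_zero p hp
  obtain rfl := Quiver.Path.eq_nil_of_length_zero p hp
  exact h a

omit hρ in
theorem sum_smul_eq_of_mem_lengthGrading_zero [DecidableEq V]
    {ε : QuiverAlgebra ρ →ₐ[K] (V → K)}
    (h0 : ∀ a, ε (proj ρ (ofPath K ⟨a, a, .nil⟩)) = Pi.single a 1)
    {x : QuiverAlgebra ρ} (hx : x ∈ lengthGrading ρ 0) :
    ∑ a, ε x a • proj ρ (ofPath K ⟨a, a, .nil⟩) = x := by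
  let F : QuiverAlgebra ρ →ₗ[K] QuiverAlgebra ρ :=
    ∑ a, ((LinearMap.proj a).comp ε.toLinearMap).smulRight (proj ρ (ofPath K ⟨a, a, .nil⟩))
  have hF (y) : F y = ∑ a, ε y a • proj ρ (ofPath K ⟨a, a, .nil⟩) := by
    simp [F, LinearMap.sum_apply]
  rw [← hF]
  refine lengthGrading_zero_le (S := LinearMap.eqLocus F LinearMap.id) |>.2 (fun a => ?_) hx
  simp [LinearMap.mem_eqLocus, hF, h0, Pi.single_apply]

/-- The degree zero part is isomorphic to `K^V`. -/
theorem lengthGrading_zero_equiv :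
    ∃ S : Subalgebra K (QuiverAlgebra ρ), Subalgebra.toSubmodule S = lengthGrading ρ 0 ∧
      Nonempty (S ≃ₐ[K] (V → K)) := by
  classical
  obtain ⟨ε, h0, -⟩ := exists_augmentation hρ
  have hmon := lengthGrading_gradedMonoid (ρ := ρ)
  refine exists_subalgebra_equiv _ hmon.one_mem (fun x hx y hy => ?_) ε
    (fun x hx hεx => ?_) (fun c => ?_)
  · have := hmon.mul_mem hx hy
    rwa [add_zero] at this
  · simpa [hεx] using (sum_smul_eq_of_mem_lengthGrading_zero h0 hx).symm
  · refine ⟨∑ a, c a • proj ρ (ofPath K ⟨a, a, .nil⟩), sum_mem fun a _ =>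
      Submodule.smul_mem _ _ (proj_mem_lengthGrading ⟨a, a, .nil⟩), ?_⟩
    simp only [map_sum, map_smul, h0]
    ext b
    simp [Finset.sum_apply, Pi.single_apply]

omit hρ in
theorem lengthGrading_fg [∀ a b : V, Finite (a ⟶ b)] (i : ℕ) : (lengthGrading ρ i).FG := by
  have h1 : (lengthGrading ρ 1).FG := lengthPart_one_fg.map _
  match i with
  | 0 => exact lengthPart_zero_fg.map _
  | 1 => exact h1
  | i + 2 => exact lengthGrading_eq_pow (ρ := ρ) (by omega : 2 ≤ i + 2) ▸ h1.pow _

-- Without vertices `1` is an empty sum, so the algebra is zero, while `K^r` with `r ≥ 1` is not.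
-- The covering quiver thereby also acquires a vertex.
omit hρ in
theorem nonempty_of_isGradedQuiverAlgebra (h : IsGradedQuiverAlgebra K (lengthGrading ρ)) :
    Nonempty V := by
  by_contra hV
  rw [not_nonempty_iff] at hV
  obtain ⟨r, hr, S, -, ⟨e⟩⟩ := h.degree_zero
  have h1 : (1 : QuiverAlgebra ρ) = 0 := by
    rw [← map_one (proj ρ), one_def, Finset.univ_eq_empty, Finset.sum_empty, map_zero]
  have h2 : (1 : S) = 0 := Subtype.ext h1
  have h3 : (1 : Fin r → K) = 0 := by rw [← map_one e, h2, map_zero]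
  exact one_ne_zero (congrFun h3 ⟨0, hr⟩)

/-- `K Q / ⟨ρ⟩` with the length grading is a graded quiver algebra. -/
theorem isGradedQuiverAlgebra [Nonempty V] [∀ a b : V, Finite (a ⟶ b)] :
    IsGradedQuiverAlgebra K (lengthGrading ρ) where
  gradedMonoid := lengthGrading_gradedMonoid
  isInternal := lengthGrading_isInternal hρ
  degree_zero := by
    obtain ⟨S, hS, ⟨e⟩⟩ := lengthGrading_zero_equiv hρ
    exact ⟨Fintype.card V, Fintype.card_pos, S, hS,
      ⟨e.trans (AlgEquiv.piCongrLeft' K (fun _ => K) (Fintype.equivFin V))⟩⟩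
  finite i := Module.Finite.iff_fg.2 (lengthGrading_fg i)
  generated i hi := lengthGrading_eq_pow hi

-- Modulo the positive ideal every element equals the combination of trivial paths read off from its
-- augmentation. Being a kernel, this ideal, which is only generated as a left ideal, is two-sided.
omit hρ in
theorem positiveIdeal_eq_ker [DecidableEq V] {ε : QuiverAlgebra ρ →ₐ[K] (V → K)}
    (h0 : ∀ a, ε (proj ρ (ofPath K ⟨a, a, .nil⟩)) = Pi.single a 1)
    (h1 : ∀ i, 1 ≤ i → ∀ x ∈ lengthGrading ρ i, ε x = 0) :
    positiveIdeal (lengthGrading ρ) = RingHom.ker ε := by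
  refine le_antisymm (Ideal.span_le.2 fun x ⟨i, hi, hx⟩ => h1 i hi x hx) fun x hx => ?_
  have key : x - ∑ a, ε x a • proj ρ (ofPath K ⟨a, a, .nil⟩) ∈ positiveIdeal (lengthGrading ρ) := by
    clear hx
    induction x using induction_on with
    | path p =>
      obtain ⟨a, b, p⟩ := p
      by_cases hp : p.length = 0
      · obtain rfl := Quiver.Path.eq_of_length_zero p hp
        obtain rfl := Quiver.Path.eq_nil_of_length_zero p hp
        simp [h0, Pi.single_apply]
      · have := h1 _ (Nat.one_le_iff_ne_zero.2 hp) _ (proj_mem_lengthGrading ⟨a, b, p⟩)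
        simp only [this, Pi.zero_apply, zero_smul, Finset.sum_const_zero, sub_zero]
        exact Ideal.subset_span ⟨_, Nat.one_le_iff_ne_zero.2 hp, proj_mem_lengthGrading ⟨a, b, p⟩⟩
    | zero => simp
    | add x y hx hy =>
      convert add_mem hx hy using 1
      simp only [map_add, Pi.add_apply, add_smul, Finset.sum_add_distrib]
      abel
    | smul c x hx =>
      convert Submodule.smul_of_tower_mem _ c hx using 1
      simp only [map_smul, Pi.smul_apply, smul_sub, Finset.smul_sum, smul_eq_mul, mul_smul]
  have hx' : ε x = 0 := hx
  simpa [hx'] using key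

theorem positiveIdeal_isTwoSided : (positiveIdeal (lengthGrading ρ)).IsTwoSided := by
  classical
  obtain ⟨ε, h0, h1⟩ := exists_augmentation hρ
  rw [positiveIdeal_eq_ker h0 h1]
  infer_instance

/-- Each coordinate of the augmentation maps onto the field `K`, so its kernel is a maximal left
ideal; these kernels intersect in the positive ideal. -/
theorem jacobson_le_positiveIdeal :
    Ring.jacobson (QuiverAlgebra ρ) ≤ positiveIdeal (lengthGrading ρ) := by
  classical
  obtain ⟨ε, h0, h1⟩ := exists_augmentation hρ
  rw [positiveIdeal_eq_ker h0 h1]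
  intro x hx
  ext a
  have hsurj : Function.Surjective ((Pi.evalAlgHom K (fun _ : V => K) a).comp ε) := fun c =>
    ⟨c • proj ρ (ofPath K ⟨a, a, .nil⟩), by simp [h0]⟩
  have := RingHom.ker_isMaximal_of_surjective
    ((Pi.evalAlgHom K (fun _ : V => K) a).comp ε).toRingHom hsurj
  exact Ring.jacobson_le_of_isMaximal (RingHom.ker
    ((Pi.evalAlgHom K (fun _ : V => K) a).comp ε).toRingHom) hx

omit hρ in
variable (ρ) in
/-- The span of the paths of length at least `k`. -/
noncomputable def tail (k : ℕ) : Submodule K (QuiverAlgebra ρ) :=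
  Submodule.span K {x | ∃ p : QuiverPath V, k ≤ p.2.2.length ∧ proj ρ (ofPath K p) = x}

omit hρ in
theorem tail_mul_le (j k : ℕ) : tail ρ j * tail ρ k ≤ tail ρ (j + k) := by
  unfold tail
  rw [Submodule.span_mul_span, Submodule.span_le]
  rintro _ ⟨_, ⟨⟨b, c, p⟩, hp, rfl⟩, _, ⟨⟨a, b', q⟩, hq, rfl⟩, rfl⟩
  dsimp only at hp hq ⊢
  rw [← map_mul, ofPath_mul_ofPath]
  by_cases hb : b = b'
  · subst hb
    rw [mulPath_of_eq]
    exact Submodule.subset_span ⟨_, by rw [Quiver.Path.length_comp]; omega, rfl⟩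
  · rw [mulPath_of_ne (by exact hb), map_zero]
    exact zero_mem _

omit hρ in
theorem mem_tail_zero (x : QuiverAlgebra ρ) : x ∈ tail ρ 0 := by
  induction x using induction_on with
  | path p => exact Submodule.subset_span ⟨p, Nat.zero_le _, rfl⟩
  | zero => exact zero_mem _
  | add x y hx hy => exact add_mem hx hy
  | smul c x hx => exact Submodule.smul_mem _ c hx

omit hρ in
theorem mem_tail_one_of_mem_positiveIdeal {x : QuiverAlgebra ρ}
    (hx : x ∈ positiveIdeal (lengthGrading ρ)) : x ∈ tail ρ 1 := by
  induction hx using Submodule.span_induction with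
  | mem x hx =>
    obtain ⟨i, hi, hx⟩ := hx
    refine lengthGrading_le_iff.2 (fun p hp => ?_) hx
    exact Submodule.subset_span ⟨p, hp ▸ hi, rfl⟩
  | zero => exact zero_mem _
  | add x y _ _ hx hy => exact add_mem hx hy
  | smul a x _ hx => exact tail_mul_le 0 1 (Submodule.mul_mem_mul (mem_tail_zero a) hx)

omit hρ in
theorem pow_mem_tail {x : QuiverAlgebra ρ} (hx : x ∈ tail ρ 1) (k : ℕ) : x ^ k ∈ tail ρ k := by
  induction k with
  | zero => exact mem_tail_zero _
  | succ k ih => rw [pow_succ]; exact tail_mul_le k 1 (Submodule.mul_mem_mul ih hx)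

/-- In a finite-dimensional space only finitely many of the independent graded pieces are nonzero.
-/
theorem exists_tail_eq_bot [FiniteDimensional K (QuiverAlgebra ρ)] : ∃ m, tail ρ m = ⊥ := by
  classical
  have hfin := WellFoundedGT.finite_ne_bot_of_iSupIndep
    (lengthGrading_isInternal hρ).submodule_iSupIndep
  obtain ⟨m, hm⟩ := hfin.bddAbove
  refine ⟨m + 1, Submodule.span_eq_bot.2 ?_⟩
  rintro _ ⟨p, hp, rfl⟩
  by_contra h
  have := hm (show lengthGrading ρ p.2.2.length ≠ ⊥ from
    fun h' => h ((Submodule.mem_bot K).1 (h' ▸ proj_mem_lengthGrading p)))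
  omega

/-- For `x` in the positive ideal every `y * x` is nilpotent, so `1 + y * x` is invertible, which is
the criterion for lying in the radical. -/
theorem jacobson_eq_positiveIdeal [FiniteDimensional K (QuiverAlgebra ρ)] :
    Ring.jacobson (QuiverAlgebra ρ) = positiveIdeal (lengthGrading ρ) := by
  refine le_antisymm (jacobson_le_positiveIdeal hρ) fun x hx => ?_
  obtain ⟨m, hm⟩ := exists_tail_eq_bot hρ
  rw [← Ideal.jacobson_bot, Ideal.mem_jacobson_iff]
  intro y
  have hnil : IsNilpotent (y * x) := ⟨m, (Submodule.mem_bot K).1 (hm ▸ pow_mem_tail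
    (mem_tail_one_of_mem_positiveIdeal (Ideal.mul_mem_left _ y hx)) m)⟩
  obtain ⟨z, hz⟩ := hnil.isUnit_one_add.exists_left_inv
  refine ⟨z, (Submodule.mem_bot _).2 ?_⟩
  rw [← hz]
  noncomm_ring

end QuiverAlgebra

/-! ### The covering of quiver algebras attached to the cyclic covering quiver -/

namespace CyclicCover

open PathAlgebra QuiverAlgebra

/-! ### Unique lifting of paths to the covering quiver -/

section Paths

variable {V : Type u} [Quiver.{v} V] {n : ℕ}

variable (V n) in
/-- The projection of the covering quiver to the base quiver. -/
def projection : CyclicCover V n ⥤q V where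
  obj x := x.base
  map e := e.1

/-- The projection of paths. -/
def projPath (p : QuiverPath (CyclicCover V n)) : QuiverPath V :=
  ⟨p.1.base, p.2.1.base, (projection V n).mapPath p.2.2⟩

theorem length_mapPath {x y : CyclicCover V n} (p : Quiver.Path x y) :
    ((projection V n).mapPath p).length = p.length := by
  induction p with
  | nil => rfl
  | cons p e ih => rw [Prefunctor.mapPath_cons, Quiver.Path.length_cons, Quiver.Path.length_cons, ih]

theorem length_projPath (p : QuiverPath (CyclicCover V n)) :
    (projPath p).2.2.length = p.2.2.length :=
  length_mapPath p.2.2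

theorem liftPathAux_fst (r : ZMod n) {a b : V} (p : Quiver.Path a b) :
    (liftPathAux r p).1 = r + p.length := by
  induction p with
  | nil => simp [liftPathAux]
  | cons p e ih => simp [liftPathAux, ih, add_assoc]

theorem length_liftPathAux (r : ZMod n) {a b : V} (p : Quiver.Path a b) :
    (liftPathAux r p).2.length = p.length := by
  induction p with
  | nil => rfl
  | cons p e ih => simp [liftPathAux, ih]

theorem length_liftPath (r : ZMod n) (p : QuiverPath V) :
    (liftPath r p).2.2.length = p.2.2.length :=
  length_liftPathAux r p.2.2

theorem liftPathAux_comp (r : ZMod n) {a b c : V} (q : Quiver.Path a b) (p : Quiver.Path b c) :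
    liftPathAux r (q.comp p) = ⟨(liftPathAux (liftPathAux r q).1 p).1,
      (liftPathAux r q).2.comp (liftPathAux (liftPathAux r q).1 p).2⟩ := by
  induction p with
  | nil => rfl
  | cons p e ih =>
    rw [Quiver.Path.comp_cons, liftPathAux, ih]
    rfl

theorem liftPathAux_mapPath {x y : CyclicCover V n} (p : Quiver.Path x y) :
    liftPathAux x.level ((projection V n).mapPath p) = ⟨y.level, p⟩ := by
  induction p with
  | nil => rfl
  | @cons y z p e ih =>
    rw [Prefunctor.mapPath_cons, liftPathAux, ih]
    obtain ⟨z, t⟩ := z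
    obtain ⟨e, h⟩ := e
    -- The level of the target is only propositionally `y.level + 1`; after substitution the arrow
    -- is a `liftArrow` by definition.
    obtain rfl : t = y.level + 1 := h
    rfl

theorem liftPath_projPath (p : QuiverPath (CyclicCover V n)) :
    liftPath p.1.level (projPath p) = p := by
  obtain ⟨x, y, p⟩ := p
  have h := liftPathAux_mapPath p
  exact congrArg (fun q : Σ s : ZMod n, Quiver.Path (⟨x.base, x.level⟩ : CyclicCover V n)
    ⟨y.base, s⟩ => (⟨x, ⟨y.base, q.1⟩, q.2⟩ : QuiverPath (CyclicCover V n))) h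

theorem mapPath_liftPathAux (r : ZMod n) {a b : V} (p : Quiver.Path a b) :
    (projection V n).mapPath (liftPathAux r p).2 = p := by
  induction p with
  | nil => rfl
  | cons p e ih =>
    rw [liftPathAux, Prefunctor.mapPath_cons, ih]
    rfl

theorem projPath_liftPath (r : ZMod n) (p : QuiverPath V) : projPath (liftPath r p) = p :=
  congrArg (fun q => (⟨p.1, p.2.1, q⟩ : QuiverPath V)) (mapPath_liftPathAux r p.2.2)

theorem level_target (p : QuiverPath (CyclicCover V n)) :
    p.2.1.level = p.1.level + p.2.2.length := by
  conv_lhs => rw [← liftPath_projPath p]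
  rw [← length_projPath]
  exact liftPathAux_fst _ _

variable (K : Type w) [Field K]

/-- The lift of `q` from level `r` ends at level `r + q.length`, the only level at which a lift of
`p` can be attached. -/
theorem mul_liftPath (s r : ZMod n) {a b c : V} (q : Quiver.Path a b) (p : Quiver.Path b c) :
    ofPath K (liftPath s ⟨b, c, p⟩) * ofPath K (liftPath r ⟨a, b, q⟩) =
      if s = r + q.length then ofPath K (liftPath r ⟨a, c, q.comp p⟩) else 0 := by
  rw [ofPath_mul_ofPath]
  split_ifs with h
  · rw [← liftPathAux_fst] at h
    subst h
    refine (mulPath_of_eq (liftPathAux r q).2 (liftPathAux _ p).2).trans (congrArg (ofPath K) ?_)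
    unfold liftPath
    dsimp only
    rw [liftPathAux_comp]
  · refine mulPath_of_ne fun h' => h ?_
    rw [← liftPathAux_fst]
    exact congrArg level h'

theorem mul_liftPath_of_ne (s r : ZMod n) {p q : QuiverPath V} (h : p.1 ≠ q.2.1) :
    ofPath K (liftPath s p) * ofPath K (liftPath r q) = 0 := by
  rw [ofPath_mul_ofPath]
  exact mulPath_of_ne fun h' => h (congrArg base h')

theorem projPath_mul {x y z : CyclicCover V n} (q : Quiver.Path x y) (p : Quiver.Path y z) :
    ofPath K (projPath ⟨y, z, p⟩) * ofPath K (projPath ⟨x, y, q⟩) =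
      ofPath K (projPath ⟨x, z, q.comp p⟩) := by
  rw [ofPath_mul_ofPath]
  refine (mulPath_of_eq ((projection V n).mapPath q) ((projection V n).mapPath p)).trans ?_
  rw [← Prefunctor.mapPath_comp]
  rfl

theorem lift_mem_lengthPart (r : ZMod n) {i : ℕ} {x : PathAlgebra K V}
    (hx : x ∈ lengthPart K V i) : lift K r x ∈ lengthPart K (CyclicCover V n) i := by
  refine lengthPart_le_iff (S := (lengthPart K (CyclicCover V n) i).comap (lift K r)) |>.2 ?_ hx
  rintro p rfl
  rw [Submodule.mem_comap, lift, linearLift_ofPath, ← length_liftPath r]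
  exact ofPath_mem_lengthPart _

end Paths

theorem sum_eq {V : Type u} [Fintype V] {n : ℕ} [NeZero n] {M : Type*} [AddCommMonoid M] (f : CyclicCover V n → M) :
    ∑ x, f x = ∑ r : ZMod n, ∑ v : V, f ⟨v, r⟩ := by
  let e : V × ZMod n ≃ CyclicCover V n :=
    { toFun := fun x => ⟨x.1, x.2⟩
      invFun := fun x => (x.base, x.level)
      left_inv := fun _ => rfl
      right_inv := fun _ => rfl }
  rw [← e.sum_comp, Fintype.sum_prod_type, Finset.sum_comm]
  rfl

/-! ### Pull-back, matrix representation and level idempotents -/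

variable {K : Type w} [Field K] {V : Type u} [Fintype V] [Quiver.{v} V] {n : ℕ} [NeZero n]
  {ρ : Set (PathAlgebra K V)}

omit [Fintype V] [NeZero n] in
theorem liftRelations_mem_lengthPart {i : ℕ} (hρ : ∀ x ∈ ρ, x ∈ lengthPart K V i) :
    ∀ x ∈ liftRelations n ρ, x ∈ lengthPart K (CyclicCover V n) i := by
  rintro _ ⟨y, hy, r, rfl⟩
  exact lift_mem_lengthPart K r (hρ y hy)

variable (n ρ) in
/-- The pull-back homomorphism to the covering algebra. -/
theorem exists_pull : ∃ φ : QuiverAlgebra ρ →ₐ[K] QuiverAlgebra (liftRelations n ρ),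
    ∀ p, φ (proj ρ (ofPath K p)) =
      ∑ r : ZMod n, proj (liftRelations n ρ) (ofPath K (liftPath r p)) := by
  obtain ⟨φ, hφ⟩ := PathAlgebra.exists_algHom (K := K)
    (fun p : QuiverPath V => ∑ r : ZMod n, proj (liftRelations n ρ) (ofPath K (liftPath r p)))
    (by
      rw [Finset.sum_comm, ← map_one (proj (liftRelations n ρ)), one_def, sum_eq]
      simp only [map_sum]
      rfl)
    (fun a b c q p => by
      -- For each lift of `q` exactly one lift of `p` starts where it ends, so the double sum
      -- collapses to the lifts of the composite.
      rw [Finset.sum_mul_sum, Finset.sum_comm]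
      refine Finset.sum_congr rfl fun r _ => ?_
      simp only [← map_mul, mul_liftPath]
      rw [← map_sum, Finset.sum_ite_eq' Finset.univ (r + (q.length : ZMod n)),
        if_pos (Finset.mem_univ _)])
    (fun p q h => by
      rw [Finset.sum_mul_sum]
      refine Finset.sum_eq_zero fun s _ => Finset.sum_eq_zero fun r _ => ?_
      rw [← map_mul, mul_liftPath_of_ne K s r h, map_zero])
  have h (x) : φ x = ∑ r : ZMod n, proj (liftRelations n ρ) (lift K r x) := by
    induction x using PathAlgebra.induction_on with
    | path p => simp only [hφ, lift, linearLift_ofPath]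
    | zero => simp
    | add x y hx hy => simp only [map_add, hx, hy, Finset.sum_add_distrib]
    | smul c x hx => simp only [map_smul, hx, Finset.smul_sum]
  obtain ⟨ψ, hψ⟩ := QuiverAlgebra.exists_algHom ρ φ fun x hx => by
    rw [h]
    exact Finset.sum_eq_zero fun r _ => proj_eq_zero_of_mem ⟨x, hx, r, rfl⟩
  exact ⟨ψ, fun p => (hψ _).trans (hφ p)⟩

variable (n) in
/-- The matrix representation of the covering algebra. -/
theorem exists_mat {i : ℕ} (hρ : ∀ x ∈ ρ, x ∈ lengthPart K V i) :
    ∃ θ : QuiverAlgebra (liftRelations n ρ) →ₐ[K] Matrix (ZMod n) (ZMod n) (QuiverAlgebra ρ),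
    ∀ p, θ (proj (liftRelations n ρ) (ofPath K p)) =
      Matrix.single p.2.1.level p.1.level (proj ρ (ofPath K (projPath p))) := by
  obtain ⟨φ, hφ⟩ := PathAlgebra.exists_algHom (K := K)
    (fun p : QuiverPath (CyclicCover V n) =>
      Matrix.single p.2.1.level p.1.level (proj ρ (ofPath K (projPath p))))
    (by
      rw [sum_eq, ← Matrix.sum_single_one]
      refine Finset.sum_congr rfl fun r _ => ?_
      rw [← map_one (proj ρ), one_def, map_sum]
      exact (map_sum (Matrix.singleAddMonoidHom (α := QuiverAlgebra ρ) r r) _ _).symm)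
    (fun a b c q p => by
      rw [Matrix.single_mul_single_same, ← map_mul, projPath_mul])
    (fun p q h => by
      by_cases hl : p.1.level = q.2.1.level
      · rw [hl, Matrix.single_mul_single_same, ← map_mul, ofPath_mul_ofPath, mulPath_of_ne,
          map_zero, Matrix.single_zero]
        intro hb
        obtain ⟨⟨v, r⟩, y, p⟩ := p
        obtain ⟨x, ⟨w, s⟩, q⟩ := q
        simp only [projPath] at hb hl
        subst hb
        exact h (congrArg (CyclicCover.mk v) hl)
      · exact Matrix.single_mul_single_of_ne _ _ _ _ hl _)
  -- All paths in a homogeneous element rise by the same number of levels, so its lift occupies a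
  -- single matrix entry; for a relation that entry is zero.
  have h (r : ZMod n) (x) (hx : x ∈ lengthPart K V i) :
      φ (lift K r x) = Matrix.single (r + i) r (proj ρ x) := by
    refine lengthPart_le_iff (S := LinearMap.eqLocus (φ.toLinearMap ∘ₗ lift K r)
      (Matrix.singleLinearMap K (r + i) r ∘ₗ (proj ρ).toLinearMap)) |>.2 ?_ hx
    rintro p rfl
    change φ (lift K r (ofPath K p)) = Matrix.single _ _ (proj ρ (ofPath K p))
    rw [lift, linearLift_ofPath, hφ, projPath_liftPath, level_target, length_liftPath]
    rfl
  obtain ⟨θ, hθ⟩ := QuiverAlgebra.exists_algHom (liftRelations n ρ) φ (by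
    rintro _ ⟨y, hy, r, rfl⟩
    rw [h r y (hρ y hy), proj_eq_zero_of_mem hy, Matrix.single_zero])
  exact ⟨θ, fun p => (hθ _).trans (hφ p)⟩

variable (ρ) in
/-- The idempotent of the covering algebra cutting out the vertices of level `r`. -/
noncomputable def levelIdem (r : ZMod n) : QuiverAlgebra (liftRelations n ρ) :=
  ∑ v : V, proj (liftRelations n ρ) (ofPath K ⟨⟨v, r⟩, ⟨v, r⟩, .nil⟩)

theorem sum_levelIdem : ∑ r : ZMod n, levelIdem ρ r = 1 := by
  rw [← map_one (proj (liftRelations n ρ)), one_def, sum_eq, map_sum]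
  simp only [map_sum]
  rfl

theorem levelIdem_mul (s : ZMod n) (p : QuiverPath (CyclicCover V n)) :
    levelIdem ρ s * proj (liftRelations n ρ) (ofPath K p) =
      if p.2.1.level = s then proj (liftRelations n ρ) (ofPath K p) else 0 := by
  obtain ⟨x, ⟨w, t⟩, p⟩ := p
  rw [levelIdem, Finset.sum_mul]
  simp only [← map_mul, ofPath_mul_ofPath]
  split_ifs with h
  · subst h
    rw [Fintype.sum_eq_single w, mulPath_of_eq, Quiver.Path.comp_nil]
    intro v hv
    rw [mulPath_of_ne, map_zero]
    exact fun h => hv (congrArg base h)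
  · refine Finset.sum_eq_zero fun v _ => ?_
    rw [mulPath_of_ne, map_zero]
    exact fun h' => h (congrArg level h').symm

theorem mul_levelIdem (r : ZMod n) (p : QuiverPath (CyclicCover V n)) :
    proj (liftRelations n ρ) (ofPath K p) * levelIdem ρ r =
      if p.1.level = r then proj (liftRelations n ρ) (ofPath K p) else 0 := by
  obtain ⟨⟨v, t⟩, y, p⟩ := p
  rw [levelIdem, Finset.mul_sum]
  simp only [← map_mul, ofPath_mul_ofPath]
  split_ifs with h
  · subst h
    rw [Fintype.sum_eq_single v, mulPath_of_eq, Quiver.Path.nil_comp]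
    intro w hw
    rw [mulPath_of_ne, map_zero]
    exact fun h => hw (congrArg base h).symm
  · refine Finset.sum_eq_zero fun w _ => ?_
    rw [mulPath_of_ne, map_zero]
    exact fun h' => h (congrArg level h')

/-! ### Verification of the covering axioms and behaviour of the positive ideals -/

section Covering

variable (φ : QuiverAlgebra ρ →ₐ[K] QuiverAlgebra (liftRelations n ρ))
  (hφ : ∀ p, φ (proj ρ (ofPath K p)) =
    ∑ r : ZMod n, proj (liftRelations n ρ) (ofPath K (liftPath r p)))
  (θ : QuiverAlgebra (liftRelations n ρ) →ₐ[K] Matrix (ZMod n) (ZMod n) (QuiverAlgebra ρ))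
  (hθ : ∀ p, θ (proj (liftRelations n ρ) (ofPath K p)) =
    Matrix.single p.2.1.level p.1.level (proj ρ (ofPath K (projPath p))))

-- The lifts of one path end at distinct levels, so the idempotent at the end of `p` singles out `p`
-- among the lifts of its projection.
include hφ in
theorem levelIdem_mul_pull (p : QuiverPath (CyclicCover V n)) :
    levelIdem ρ p.2.1.level * φ (proj ρ (ofPath K (projPath p))) =
      proj (liftRelations n ρ) (ofPath K p) := by
  rw [hφ, Finset.mul_sum]
  simp only [levelIdem_mul]
  rw [Fintype.sum_eq_single p.1.level, liftPath_projPath, if_pos rfl]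
  intro r hr
  refine if_neg fun h => hr ?_
  rw [level_target, level_target p, length_liftPath, length_projPath] at h
  exact add_right_cancel h

include hθ in
theorem mat_levelIdem (r : ZMod n) : θ (levelIdem ρ r) = Matrix.single r r 1 := by
  rw [levelIdem, map_sum, ← map_one (proj ρ), one_def, map_sum]
  simp only [hθ]
  exact (map_sum (Matrix.singleAddMonoidHom (α := QuiverAlgebra ρ) r r) _ _).symm

-- Exactly one lift of a path ends at level `s`, namely the one starting at `s` minus its length.
include hφ hθ in
theorem sum_mat_pull (a : QuiverAlgebra ρ) (s : ZMod n) : ∑ r, θ (φ a) s r = a := by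
  induction a using QuiverAlgebra.induction_on with
  | path p =>
    simp only [hφ, map_sum, hθ, projPath_liftPath, Matrix.sum_apply]
    have h (t r : ZMod n) : Matrix.single (liftPath t p).2.1.level (liftPath t p).1.level
        (proj ρ (ofPath K p)) s r =
        if t = r then (if r = s - p.2.2.length then proj ρ (ofPath K p) else 0) else 0 := by
      rw [level_target, length_liftPath, Matrix.single_apply]
      change (if t + _ = s ∧ t = r then _ else _) = _
      by_cases htr : t = r
      · subst htr
        simp [eq_sub_iff_add_eq]
      · simp [htr]
    simp only [h]
    simp
  | zero => simp
  | add x y hx hy => simp only [map_add, Matrix.add_apply, Finset.sum_add_distrib, hx, hy]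
  | smul c x hx => simp only [map_smul, Matrix.smul_apply, ← Finset.smul_sum, hx]

include hφ hθ in
theorem sum_levelIdem_pull (x : QuiverAlgebra (liftRelations n ρ)) (r : ZMod n) :
    ∑ s, levelIdem ρ s * φ (θ x s r) = x * levelIdem ρ r := by
  induction x using QuiverAlgebra.induction_on with
  | path p =>
    rw [mul_levelIdem, Fintype.sum_eq_single p.2.1.level]
    · rw [hθ, Matrix.single_apply]
      by_cases h : p.1.level = r
      · rw [if_pos h, if_pos ⟨rfl, h⟩, levelIdem_mul_pull φ hφ]
      · rw [if_neg h, if_neg fun h' => h h'.2, map_zero, mul_zero]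
    · intro s hs
      rw [hθ, Matrix.single_apply, if_neg fun h => hs h.1.symm, map_zero, mul_zero]
  | zero => simp
  | add x y hx hy =>
    simp only [map_add, Matrix.add_apply, mul_add, add_mul, Finset.sum_add_distrib, hx, hy]
  | smul c x hx =>
    simp only [map_smul, Matrix.smul_apply, mul_smul_comm, smul_mul_assoc, ← Finset.smul_sum, hx]

/-- The covering algebra as a ring covering. -/
noncomputable def ringCovering :
    RingCovering (ZMod n) (QuiverAlgebra ρ) (QuiverAlgebra (liftRelations n ρ)) where
  pull := φ
  mat := θ
  idem := levelIdem ρ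
  sum_idem := sum_levelIdem
  mat_idem := mat_levelIdem θ hθ
  sum_mat_pull := sum_mat_pull φ hφ θ hθ
  sum_idem_pull := sum_levelIdem_pull φ hφ θ hθ

include hφ in
theorem pull_mem_positiveIdeal {a : QuiverAlgebra ρ} (ha : a ∈ positiveIdeal (lengthGrading ρ)) :
    φ a ∈ positiveIdeal (lengthGrading (liftRelations n ρ)) := by
  induction ha using Submodule.span_induction with
  | mem a ha =>
    obtain ⟨i, hi, ha⟩ := ha
    refine Ideal.subset_span ⟨i, hi, ?_⟩
    refine lengthGrading_le_iff (S := (lengthGrading (liftRelations n ρ) i).comap φ.toLinearMap)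
      |>.2 ?_ ha
    rintro p rfl
    rw [Submodule.mem_comap, AlgHom.toLinearMap_apply]
    rw [hφ]
    exact sum_mem fun r _ => length_liftPath r p ▸ proj_mem_lengthGrading _
  | zero => rw [map_zero]; exact zero_mem _
  | add x y _ _ hx hy => rw [map_add]; exact add_mem hx hy
  | smul a x _ hx => rw [smul_eq_mul, map_mul]; exact Ideal.mul_mem_left _ _ hx

include hθ in
theorem mat_mem_lengthGrading {i : ℕ} {x : QuiverAlgebra (liftRelations n ρ)}
    (hx : x ∈ lengthGrading (liftRelations n ρ) i) (s r : ZMod n) :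
    θ x s r ∈ lengthGrading ρ i := by
  refine lengthGrading_le_iff (S := (lengthGrading ρ i).comap
    (Matrix.entryLinearMap K (QuiverAlgebra ρ) s r ∘ₗ θ.toLinearMap)) |>.2 ?_ hx
  rintro p rfl
  change θ (proj (liftRelations n ρ) (ofPath K p)) s r ∈ lengthGrading ρ p.2.2.length
  rw [hθ, Matrix.single_apply]
  split_ifs
  · exact length_projPath p ▸ proj_mem_lengthGrading _
  · exact zero_mem _

include hθ in
theorem mat_mem_positiveIdeal {x : QuiverAlgebra (liftRelations n ρ)}
    (hx : x ∈ positiveIdeal (lengthGrading (liftRelations n ρ))) (s r : ZMod n) :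
    θ x s r ∈ positiveIdeal (lengthGrading ρ) := by
  induction hx using Submodule.span_induction generalizing s with
  | mem x hx =>
    obtain ⟨i, hi, hx⟩ := hx
    exact Ideal.subset_span ⟨i, hi, mat_mem_lengthGrading θ hθ hx s r⟩
  | zero => rw [map_zero]; exact zero_mem _
  | add x y _ _ hx hy => rw [map_add]; exact add_mem (hx s) (hy s)
  | smul a x _ hx =>
    rw [smul_eq_mul, map_mul, Matrix.mul_apply]
    exact sum_mem fun t _ => Ideal.mul_mem_left _ _ (hx t)

-- A path contributing to an off-diagonal entry changes level, so its length is positive.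
include hθ in
theorem mat_mem_positiveIdeal_of_ne (x : QuiverAlgebra (liftRelations n ρ)) (s r : ZMod n)
    (h : s ≠ r) : θ x s r ∈ positiveIdeal (lengthGrading ρ) := by
  induction x using QuiverAlgebra.induction_on with
  | path p =>
    rw [hθ, Matrix.single_apply]
    split_ifs with hp
    · refine Ideal.subset_span ⟨_, Nat.one_le_iff_ne_zero.2 fun hl => h ?_, proj_mem_lengthGrading _⟩
      rw [← hp.1, ← hp.2, level_target, ← length_projPath, hl, Nat.cast_zero, add_zero]
    · exact zero_mem _
  | zero => rw [map_zero]; exact zero_mem _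
  | add x y hx hy => rw [map_add]; exact add_mem hx hy
  | smul c x hx => rw [map_smul]; exact Submodule.smul_of_tower_mem _ c hx

-- Summing `sum_levelIdem_pull` over `r` rebuilds `x` from the row sums of its matrix, so `A^n` maps
-- linearly onto the covering algebra.
include hφ hθ in
theorem finiteDimensional [FiniteDimensional K (QuiverAlgebra ρ)] :
    FiniteDimensional K (QuiverAlgebra (liftRelations n ρ)) := by
  let F : (ZMod n → QuiverAlgebra ρ) →ₗ[K] QuiverAlgebra (liftRelations n ρ) :=
    ∑ s, (LinearMap.mulLeft K (levelIdem ρ s) ∘ₗ φ.toLinearMap) ∘ₗ LinearMap.proj s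
  have hF (f) : F f = ∑ s, levelIdem ρ s * φ (f s) := by
    simp [F, LinearMap.sum_apply]
  refine Module.Finite.of_surjective F fun x => ⟨fun s => ∑ r, θ x s r, ?_⟩
  conv_rhs => rw [← mul_one x, ← sum_levelIdem, Finset.mul_sum]
  simp only [hF, map_sum, Finset.mul_sum, ← sum_levelIdem_pull φ hφ θ hθ x]
  exact Finset.sum_comm

end Covering

end CyclicCover

/-! ### Koszulness of the covering algebra -/

theorem mainTheorem6 (K : Type w) [Field K] (V : Type u) [Fintype V] [Quiver.{v} V]
    [∀ a b : V, Finite (a ⟶ b)]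
    (ρ : Set (PathAlgebra K V)) (hρ : ∀ x ∈ ρ, x ∈ PathAlgebra.lengthPart K V 2)
    (n : ℕ) [NeZero n] (hn : 2 ≤ n) (hchar : ¬ ringChar K ∣ n) :
    (FiniteDimensional K (QuiverAlgebra ρ) →
      IsKoszul K (QuiverAlgebra.lengthGrading ρ) →
        FiniteDimensional K (QuiverAlgebra (CyclicCover.liftRelations n ρ)) ∧
        IsKoszul K (QuiverAlgebra.lengthGrading (CyclicCover.liftRelations n ρ))) ∧
    (IsGradedKoszul K (QuiverAlgebra.lengthGrading ρ) →
      IsGradedKoszul K (QuiverAlgebra.lengthGrading (CyclicCover.liftRelations n ρ))) := by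
  obtain ⟨φ, hφ⟩ := CyclicCover.exists_pull n ρ
  obtain ⟨θ, hθ⟩ := CyclicCover.exists_mat n hρ
  have hρ' := CyclicCover.liftRelations_mem_lengthPart (n := n) hρ
  have hgraded (h : IsGradedQuiverAlgebra K (QuiverAlgebra.lengthGrading ρ)) :
      IsGradedQuiverAlgebra K
        (QuiverAlgebra.lengthGrading (CyclicCover.liftRelations n ρ)) := by
    have : Nonempty V := QuiverAlgebra.nonempty_of_isGradedQuiverAlgebra h
    have : Nonempty (CyclicCover V n) := this.map fun v => ⟨v, 0⟩
    have (a b : CyclicCover V n) : Finite (a ⟶ b) := Subtype.finite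
    exact QuiverAlgebra.isGradedQuiverAlgebra hρ'
  have := QuiverAlgebra.positiveIdeal_isTwoSided hρ
  have hext := (CyclicCover.ringCovering φ hφ θ hθ).extGeneratedInDegreeZeroOne
    (positiveIdeal (QuiverAlgebra.lengthGrading ρ))
    (positiveIdeal (QuiverAlgebra.lengthGrading (CyclicCover.liftRelations n ρ)))
    (CyclicCover.mat_mem_positiveIdeal_of_ne θ hθ)
    (fun a ha => CyclicCover.pull_mem_positiveIdeal φ hφ ha)
    (fun x hx s => CyclicCover.mat_mem_positiveIdeal θ hθ hx s s)
  refine ⟨fun hfin h => ?_, fun h => ⟨hgraded h.1, hext h.2⟩⟩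
  have hfin' := CyclicCover.finiteDimensional φ hφ θ hθ
  refine ⟨hfin', hgraded h.1, ?_⟩
  -- Both algebras are finite-dimensional, so both radicals are the positive ideals and the graded
  -- transfer applies.
  have hE := h.2
  unfold IsQuasiKoszul at hE ⊢
  rw [QuiverAlgebra.jacobson_eq_positiveIdeal hρ] at hE
  rw [QuiverAlgebra.jacobson_eq_positiveIdeal hρ']
  exact hext hE
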